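/- Let $\mathbb D$ be the open unit disc, $\sigma$ the area measure on $\mathbb D$ normalized by $\sigma(\mathbb D)=1$, and for $1<p<\infty$ let $A^p$ be the space of analytic functions $f$ in $\mathbb D$ with $\|f\|_{A^p}=\left(\int_{\mathbb D}|f|^p\,d\sigma\right)^{1/p}<\infty$. Let $z_1,\dots,z_N$ be distinct points of $\mathbb D$ and $d_1,\dots,d_N$ positive integers, let $N^p$ be the set of all $f\in A^p$ that vanish at each $z_n$ to order at least $d_n$, and let $m=d_i$ if $z_i=0$ for some $i$, and $m=0$ if no $z_n$ is $0$. A canonical divisor of this zero set in $A^p$ is a function $G\in N^p$ with $\|G\|_{A^p}=1$ and $G^{(m)}(0)>0$ such that $F^{(m)}(0)\le G^{(m)}(0)$ for every $F\in N^p$ with $\|F\|_{A^p}=1$ and $F^{(m)}(0)>0$. Theorem. Let $p\ge 2$ be an even integer. Then the zero set has exactly one canonical divisor in $A^p$. A function $G$ is this canonical divisor if and only if $G\in A^p$, $\|G\|_{A^p}=1$, $G^{(m)}(0)>0$, the function $G^{p/2}$ has a zero of order exactly $pd_n/2$ at $z_n$ for each $n$, and there are complex constants $c_0$ and $c_{nj}$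 such that for all $z\in\mathbb D$ $$G(z)^{p/2}=c_0+\sum_{n=1}^N\sum_{j=0}^{(p/2)d_n-1}\frac{c_{nj}}{(1-\overline{z_n}z)^{j+2}}$$ if $z_n\ne0$ for all $n$, and $$G(z)^{p/2}=c_0z^{(p/2)d_i}+\sum_{j=0}^{(p/2)d_i-1}c_{ij}z^j+\sum_{n\ne i}\sum_{j=0}^{(p/2)d_n-1}\frac{c_{nj}}{(1-\overline{z_n}z)^{j+2}}$$ if $z_i=0$. Moreover, in the "if" direction it is enough that $G^{p/2}$ has a zero of order at least $pd_n/2$ at each $z_n$. -/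

import Mathlib

open MeasureTheory
open scoped ENNReal ComplexOrder ComplexConjugate

namespace Bergman

/-- Normalized area measure on the open unit disc of `ℂ`. -/
noncomputable def area : Measure ℂ :=
  (volume (Metric.ball (0 : ℂ) 1))⁻¹ • volume.restrict (Metric.ball (0 : ℂ) 1)

/-- Membership in the Bergman space `A^p`: analytic in the open unit disc, and in `L^p` of
normalized area measure. Only the values of `f` in the disc matter. -/
structure MemSpace (p : ℝ≥0∞) (f : ℂ → ℂ) : Prop where
  analytic : AnalyticOnNhd ℂ f (Metric.ball 0 1)
  memLp : MemLp f p area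

/-- The `A^p` norm, with values in `[0, ∞]`. -/
noncomputable def norm (p : ℝ≥0∞) (f : ℂ → ℂ) : ℝ≥0∞ :=
  eLpNorm f p area

/-- The space `N^p` of a finite zero set (points `z n` with multiplicities `d n`): the functions
in `A^p` that vanish at every `z n` to order at least `d n`. -/
structure MemZeroSpace (p : ℝ≥0∞) {N : ℕ} (z : Fin N → ℂ) (d : Fin N → ℕ) (f : ℂ → ℂ) :
    Prop where
  memSpace : MemSpace p f
  vanish : ∀ n, (d n : ℕ∞) ≤ analyticOrderAt f (z n)

/-- The multiplicity of the origin in the zero set (`0` if no `z n` is the origin). -/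
noncomputable def orderAtOrigin {N : ℕ} (z : Fin N → ℂ) (d : Fin N → ℕ) : ℕ :=
  open Classical in ∑ n, if z n = 0 then d n else 0

/-- `G` is a canonical divisor in `A^p` of the given zero set: with `m` the multiplicity of the
origin, `G` maximizes `G^(m)(0)` among the functions in `N^p` of norm one whose `m`-th derivative
at the origin is (real and) positive. -/
structure IsCanonicalDivisor (p : ℝ≥0∞) {N : ℕ} (z : Fin N → ℂ) (d : Fin N → ℕ) (G : ℂ → ℂ) :
    Prop where
  mem : MemZeroSpace p z d G
  norm_eq_one : norm p G = 1
  pos : 0 < iteratedDeriv (orderAtOrigin z d) G 0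
  le_of_competitor : ∀ F : ℂ → ℂ, MemZeroSpace p z d F → norm p F = 1 →
    0 < iteratedDeriv (orderAtOrigin z d) F 0 →
    iteratedDeriv (orderAtOrigin z d) F 0 ≤ iteratedDeriv (orderAtOrigin z d) G 0

/-- In the disc, `g` is a combination of a constant and of the functions
`(1 - conj (z n) * w) ^ (-(j + 2))`, for `j < k * d n`, if no `z n` is the origin; if `z i = 0`,
then the terms for `n = i` are the powers `w ^ j`, and the constant becomes a multiple
of `w ^ (k * d i)`. -/
def HasCanonicalForm (k : ℕ) {N : ℕ} (z : Fin N → ℂ) (d : Fin N → ℕ) (g : ℂ → ℂ) : Prop :=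
  ((∀ n, z n ≠ 0) → ∃ (c₀ : ℂ) (c : Fin N → ℕ → ℂ), ∀ w ∈ Metric.ball (0 : ℂ) 1,
    g w = c₀ + ∑ n, ∑ j ∈ Finset.range (k * d n), c n j / (1 - conj (z n) * w) ^ (j + 2)) ∧
  (∀ i, z i = 0 → ∃ (c₀ : ℂ) (c : Fin N → ℕ → ℂ), ∀ w ∈ Metric.ball (0 : ℂ) 1,
    g w = c₀ * w ^ (k * d i) + ∑ j ∈ Finset.range (k * d i), c i j * w ^ j +
      ∑ n ∈ Finset.univ.erase i, ∑ j ∈ Finset.range (k * d n),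
        c n j / (1 - conj (z n) * w) ^ (j + 2))

end Bergman

namespace Bergman

/-! ### Area measure -/

/-! Write `p = 2k` with `k = l + 1`. Then `g = G ^ k` lies in `A^2`, and `∫ |G|^p = ∫ |g|^2`, so a
nonlinear problem for `G` becomes a Hilbert space problem for `g` with multiplicities `k * d n`.

In `A^2`, vanishing to order `K` at `a` means orthogonality to `K` derivative kernels at `a`, which
span the same space as the fractions of the canonical form. Let `M` be `k` times the order at the
origin. Projecting `w ^ M` away from that span gives a nonzero `g` with the required zeros and the
canonical form (`exists_hasCanonicalForm_vanishing`). Conversely, against every `q` with these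
zeros, a function of canonical form represents a multiple of `q^(M)(0)`.

To take a `k`-th root, `g` must have no further zeros (`not_exists_extra_zero`). Shimorin's
inequality, carried to any point by the disc automorphisms, shows that dividing by the one-point
divisor at an extra zero lowers the norm by a definite factor. Cauchy-Schwarz applied to the
representing property contradicts this.

For sufficiency and uniqueness, `q = G ^ (k-1) * F` is tested for `F` in `N^p`. The integral of
`conj (G ^ k) * q` is the ratio of the derivatives of `F` and `G` at the origin
(`integral_conj_pow_mul_eq`). Young's inequality bounds its real part by 1, with a square remainder
that forces `F = G` in case of equality (`re_integral_add_le`). Necessity then follows: any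
canonical divisor is the constructed one. -/

lemma volume_unitBall : volume (Metric.ball (0 : ℂ) 1) = ENNReal.ofReal Real.pi := by
  rw [Complex.volume_ball]
  simp [← ENNReal.ofReal_coe_nnreal]

instance : IsProbabilityMeasure area where
  measure_univ := by
    have h : volume (Metric.ball (0 : ℂ) 1) ≠ 0 := (Metric.measure_ball_pos _ _ one_pos).ne'
    simp only [area, Measure.smul_apply, Measure.restrict_apply MeasurableSet.univ,
      Set.univ_inter, smul_eq_mul]
    exact ENNReal.inv_mul_cancel h measure_ball_lt_top.ne

lemma lintegral_area (f : ℂ → ℝ≥0∞) :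
    ∫⁻ w, f w ∂area = (ENNReal.ofReal Real.pi)⁻¹ * ∫⁻ w in Metric.ball 0 1, f w := by
  rw [area, lintegral_smul_measure, volume_unitBall, smul_eq_mul]

lemma ae_area_of_forall {P : ℂ → Prop} (h : ∀ w ∈ Metric.ball (0 : ℂ) 1, P w) :
    ∀ᵐ w ∂area, P w :=
  Measure.ae_smul_measure (ae_restrict_of_forall_mem measurableSet_ball h) _

lemma aestronglyMeasurable_area {f : ℂ → ℂ} (hf : ContinuousOn f (Metric.ball 0 1)) :
    AEStronglyMeasurable f area :=
  (hf.aestronglyMeasurable measurableSet_ball).smul_measure _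

/-- If two functions that are continuous in the disc are equal almost everywhere, then they are
equal in the disc. -/
lemma eqOn_of_ae_eq {f g : ℂ → ℂ} (hf : ContinuousOn f (Metric.ball 0 1))
    (hg : ContinuousOn g (Metric.ball 0 1)) (h : f =ᵐ[area] g) :
    Set.EqOn f g (Metric.ball 0 1) := by
  refine Measure.eqOn_open_of_ae_eq (μ := (volume : Measure ℂ)) ?_ Metric.isOpen_ball hf hg
  have hc : (volume (Metric.ball (0 : ℂ) 1))⁻¹ ≠ 0 := ENNReal.inv_ne_zero.2 measure_ball_lt_top.ne
  exact (Measure.ae_ennreal_smul_measure_iff hc).1 h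

/-! ### Parseval's formula in the disc -/

lemma intervalIntegral_exp_int_mul (k : ℤ) :
    ∫ θ in (-Real.pi)..Real.pi, Complex.exp (k * θ * Complex.I) =
      if k = 0 then (2 * Real.pi : ℂ) else 0 := by
  split_ifs with h
  · subst h
    simp
    ring
  · have h' : (k * Complex.I : ℂ) ≠ 0 := by simp [h]
    have e : ∀ θ : ℝ, Complex.exp (k * θ * Complex.I) = Complex.exp (k * Complex.I * θ) :=
      fun θ => by ring_nf
    simp_rw [e]
    rw [integral_exp_mul_complex h', div_eq_zero_iff, sub_eq_zero]
    left
    rw [Complex.exp_eq_exp_iff_exists_int]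
    exact ⟨k, by push_cast; ring⟩

/-- The squared modulus is expanded as an absolutely convergent double series over `ℕ × ℕ`.
Integration in `θ` kills the off-diagonal terms. -/
lemma hasSum_circle {a : ℕ → ℂ} {r : ℝ} (hr : 0 ≤ r)
    (hs : Summable fun n => ‖a n‖ * r ^ n) :
    HasSum (fun n => 2 * Real.pi * (‖a n‖ ^ 2 * r ^ (2 * n)))
      (∫ θ in (-Real.pi)..Real.pi, ‖∑' n, a n * (r * Complex.exp (θ * Complex.I)) ^ n‖ ^ 2) := by
  set w : ℝ → ℂ := fun θ => r * Complex.exp (θ * Complex.I) with hw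
  have hwn : ∀ θ, ‖w θ‖ = r := fun θ => by
    simp [hw, Complex.norm_exp_ofReal_mul_I, abs_of_nonneg hr]
  let F : ℕ × ℕ → ℝ → ℂ := fun p θ => (a p.1 * w θ ^ p.1) * conj (a p.2 * w θ ^ p.2)
  have hFn : ∀ p θ, ‖F p θ‖ = (‖a p.1‖ * r ^ p.1) * (‖a p.2‖ * r ^ p.2) := fun p θ => by
    simp [F, hwn]
  have hFc : ∀ p, Continuous (F p) := fun p => by
    simp only [F, hw]; fun_prop
  have hlt : -Real.pi ≤ Real.pi := by linarith [Real.pi_pos]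
  have key := hasSum_integral_of_summable_integral_norm
    (μ := volume.restrict (Set.Ioc (-Real.pi) Real.pi)) (F := F)
    (fun p => ((hFc p).integrableOn_Icc).mono_set Set.Ioc_subset_Icc_self) (by
      simp_rw [hFn]
      simp only [integral_const]
      refine Summable.const_smul _ ?_
      exact hs.mul_of_nonneg hs (fun n => by positivity) (fun n => by positivity))
  have hI : ∀ n m, ∫ θ in Set.Ioc (-Real.pi) Real.pi, F (n, m) θ =
      if n = m then ((2 * Real.pi * (‖a n‖ ^ 2 * r ^ (2 * n)) : ℝ) : ℂ) else 0 := by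
    intro n m
    have e : ∀ θ, F (n, m) θ = (a n * conj (a m) * r ^ (n + m)) *
        Complex.exp (((n - m : ℤ) : ℂ) * θ * Complex.I) := by
      intro θ
      simp only [F, hw, map_mul, map_pow, mul_pow, ← Complex.exp_conj, Complex.conj_ofReal,
        Complex.conj_I, ← Complex.exp_nat_mul, Complex.conj_natCast]
      have : Complex.exp (((n - m : ℤ) : ℂ) * θ * Complex.I) =
        Complex.exp (n * (θ * Complex.I)) * Complex.exp (m * (θ * -Complex.I)) := by
        rw [← Complex.exp_add]; congr 1; push_cast; ring
      rw [this, pow_add]; ring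
    simp_rw [e]
    rw [integral_const_mul, ← intervalIntegral.integral_of_le hlt, intervalIntegral_exp_int_mul]
    by_cases h : n = m
    · subst h
      simp only [sub_self, if_true]
      rw [Complex.mul_conj']
      push_cast
      ring
    · have : (n - m : ℤ) ≠ 0 := by omega
      simp [h, this]
  have h2 := key.prod_fiberwise (g := fun n => ((2 * Real.pi * (‖a n‖ ^ 2 * r ^ (2 * n)) : ℝ) : ℂ)) (fun n => by
      have := hasSum_single (f := fun m => ∫ θ in Set.Ioc (-Real.pi) Real.pi, F (n, m) θ) n
        (fun m hm => by rw [hI, if_neg hm.symm])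
      rwa [hI, if_pos rfl] at this)
  have h3 : (∫ θ in Set.Ioc (-Real.pi) Real.pi, ∑' p, F p θ) =
      ((∫ θ in (-Real.pi)..Real.pi, ‖∑' n, a n * w θ ^ n‖ ^ 2 : ℝ) : ℂ) := by
    rw [← intervalIntegral.integral_ofReal, intervalIntegral.integral_of_le hlt]
    refine integral_congr_ae (Filter.Eventually.of_forall fun θ => ?_)
    have hsn : Summable fun n => ‖a n * w θ ^ n‖ := by simpa [hwn] using hs
    have hsn' : Summable fun n => ‖conj (a n * w θ ^ n)‖ := by simpa [hwn] using hs
    simp only [F]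
    rw [← tsum_mul_tsum_of_summable_norm hsn hsn', ← Complex.conj_tsum, Complex.mul_conj']
    push_cast
    rfl
  rw [h3] at h2
  exact_mod_cast h2

lemma summable_norm_of_hasSum_ball {f : ℂ → ℂ} {a : ℕ → ℂ}
    (h : ∀ w ∈ Metric.ball (0 : ℂ) 1, HasSum (fun n => a n * w ^ n) (f w)) {r : ℝ} (hr : 0 ≤ r)
    (hr1 : r < 1) : Summable fun n => ‖a n‖ * r ^ n := by
  have : (r : ℂ) ∈ Metric.ball (0 : ℂ) 1 := by simpa [abs_of_nonneg hr] using hr1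
  simpa [abs_of_nonneg hr] using (h _ this).summable.norm

lemma lintegral_ball_eq_polar {F : ℂ → ℝ≥0∞} (hF : Measurable F) :
    ∫⁻ w in Metric.ball 0 1, F w = ∫⁻ r in Set.Ioo (0 : ℝ) 1, ENNReal.ofReal r *
      ∫⁻ θ in Set.Ioo (-Real.pi) Real.pi, F (r * Complex.exp (θ * Complex.I)) := by
  have hm : Measurable ((Metric.ball (0 : ℂ) 1).indicator F) := hF.indicator measurableSet_ball
  rw [← lintegral_indicator measurableSet_ball, ← Complex.lintegral_comp_polarCoord_symm]
  have e : ∀ p : ℝ × ℝ, Complex.polarCoord.symm p = p.1 * Complex.exp (p.2 * Complex.I) := by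
    intro p
    rw [Complex.polarCoord_symm_apply, Complex.exp_mul_I]
    push_cast
    rfl
  have hm2 : Measurable fun p : ℝ × ℝ => ENNReal.ofReal p.1 •
      (Metric.ball (0 : ℂ) 1).indicator F (p.1 * Complex.exp (p.2 * Complex.I)) := by
    refine (ENNReal.measurable_ofReal.comp measurable_fst).smul (hm.comp ?_)
    fun_prop
  simp_rw [e]
  rw [polarCoord_target, Measure.volume_eq_prod, ← Measure.prod_restrict,
    lintegral_prod _ hm2.aemeasurable]
  rw [← lintegral_indicator measurableSet_Ioi, ← lintegral_indicator measurableSet_Ioo]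
  congr 1
  ext r
  by_cases h0 : 0 < r
  · have hn : ∀ θ : ℝ, ‖(r : ℂ) * Complex.exp (θ * Complex.I)‖ = r := fun θ => by
      simp [Complex.norm_exp_ofReal_mul_I, abs_of_pos h0]
    by_cases h1 : r < 1
    · rw [Set.indicator_of_mem (show r ∈ Set.Ioi 0 from h0),
        Set.indicator_of_mem (show r ∈ Set.Ioo 0 1 from ⟨h0, h1⟩)]
      simp only [smul_eq_mul]
      rw [lintegral_const_mul' _ _ ENNReal.ofReal_ne_top]
      congr 1
      refine lintegral_congr fun θ => ?_
      rw [Set.indicator_of_mem]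
      simpa [abs_of_pos h0] using h1
    · rw [Set.indicator_of_mem (show r ∈ Set.Ioi 0 from h0),
        Set.indicator_of_notMem (fun h => h1 h.2)]
      rw [lintegral_eq_zero_iff' (by fun_prop)]
      refine Filter.Eventually.of_forall fun θ => ?_
      simp only [smul_eq_mul]
      rw [Set.indicator_of_notMem, mul_zero, Pi.zero_apply]
      simpa [abs_of_pos h0] using not_lt.1 h1
  · rw [Set.indicator_of_notMem (show r ∉ Set.Ioi 0 from h0), Set.indicator_of_notMem (fun h => h0 h.1)]

lemma lintegral_Ioo_pow (n : ℕ) :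
    ∫⁻ r in Set.Ioo (0 : ℝ) 1, ENNReal.ofReal (r ^ n) = ENNReal.ofReal (1 / (n + 1)) := by
  rw [← ofReal_integral_eq_lintegral_ofReal]
  · rw [← integral_Ioc_eq_integral_Ioo, ← intervalIntegral.integral_of_le zero_le_one,
      integral_pow]
    simp
  · exact ((continuous_pow n).integrableOn_Icc (a := 0) (b := 1)).mono_set Set.Ioo_subset_Icc_self
  · exact ae_restrict_of_forall_mem measurableSet_Ioo fun r hr => pow_nonneg hr.1.le _

/-- Parseval's formula in the Bergman space. -/
lemma lintegral_normSq_eq_tsum {f : ℂ → ℂ} {a : ℕ → ℂ}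
    (h : ∀ w ∈ Metric.ball (0 : ℂ) 1, HasSum (fun n => a n * w ^ n) (f w)) :
    ∫⁻ w, ENNReal.ofReal (‖f w‖ ^ 2) ∂area = ∑' n, ENNReal.ofReal (‖a n‖ ^ 2 / (n + 1)) := by
  -- `f` is arbitrary outside the disc; the sum of the series is a globally measurable replacement.
  -- No integrability is assumed, so both sides may be infinite.
  let g : ℂ → ℂ := fun w => ∑' n, a n * w ^ n
  have hg : Measurable g := Measurable.tsum (fun n => by fun_prop)
  have hfg : ∀ w ∈ Metric.ball (0 : ℂ) 1, f w = g w := fun w hw => (h w hw).tsum_eq.symm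
  rw [lintegral_area, setLIntegral_congr_fun (g := fun w => ENNReal.ofReal (‖g w‖ ^ 2))
    measurableSet_ball (fun w hw => by simp only [hfg w hw]),
    lintegral_ball_eq_polar (by fun_prop)]
  have hin : ∀ r ∈ Set.Ioo (0 : ℝ) 1, ENNReal.ofReal r * ∫⁻ θ in Set.Ioo (-Real.pi) Real.pi,
      ENNReal.ofReal (‖g (r * Complex.exp (θ * Complex.I))‖ ^ 2) =
      ∑' n, ENNReal.ofReal (2 * Real.pi * ‖a n‖ ^ 2) * ENNReal.ofReal (r ^ (2 * n + 1)) := by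
    intro r hr
    have hs := summable_norm_of_hasSum_ball h hr.1.le hr.2
    have hc := hasSum_circle hr.1.le hs
    have hcont : Continuous fun θ : ℝ => g (r * Complex.exp (θ * Complex.I)) := by
      refine continuous_tsum (u := fun n => ‖a n‖ * r ^ n) (fun n => by fun_prop) hs fun n θ => ?_
      simp [Complex.norm_exp_ofReal_mul_I, abs_of_pos hr.1]
    rw [Measure.restrict_congr_set Ioo_ae_eq_Ioc, ← ofReal_integral_eq_lintegral_ofReal,
      ← intervalIntegral.integral_of_le (by linarith [Real.pi_pos]), ← hc.tsum_eq,
      ENNReal.ofReal_tsum_of_nonneg (fun n => by have := hr.1; positivity) hc.summable,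
      ← ENNReal.tsum_mul_left]
    · refine tsum_congr fun n => ?_
      rw [← ENNReal.ofReal_mul hr.1.le, ← ENNReal.ofReal_mul (by positivity)]
      congr 1
      ring
    · exact ((hcont.norm.pow 2).integrableOn_Icc).mono_set Set.Ioc_subset_Icc_self
    · exact Filter.Eventually.of_forall fun θ => by positivity
  rw [setLIntegral_congr_fun measurableSet_Ioo hin, lintegral_tsum (fun n => by fun_prop),
    ← ENNReal.tsum_mul_left]
  refine tsum_congr fun n => ?_
  rw [lintegral_const_mul' _ _ ENNReal.ofReal_ne_top, lintegral_Ioo_pow,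
    ← ENNReal.ofReal_inv_of_pos Real.pi_pos, ← ENNReal.ofReal_mul (by positivity),
    ← ENNReal.ofReal_mul (by positivity)]
  congr 1
  have := Real.pi_pos
  push_cast
  field_simp
  ring


/-! ### The inequality of Shimorin and the single zero divisor -/

/-- The square of the norm in `A^2`, with values in `[0, ∞]`. -/
noncomputable def normSq (f : ℂ → ℂ) : ℝ≥0∞ := ∫⁻ w, ENNReal.ofReal (‖f w‖ ^ 2) ∂area

lemma normSq_congr {f g : ℂ → ℂ} (h : Set.EqOn f g (Metric.ball 0 1)) : normSq f = normSq g :=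
  lintegral_congr_ae (ae_area_of_forall fun w hw => by simp only [h hw])

lemma normSq_const_mul (c : ℂ) (f : ℂ → ℂ) :
    normSq (fun w => c * f w) = ENNReal.ofReal (‖c‖ ^ 2) * normSq f := by
  rw [normSq, normSq, ← lintegral_const_mul' _ _ ENNReal.ofReal_ne_top]
  refine lintegral_congr fun w => ?_
  rw [← ENNReal.ofReal_mul (by positivity), norm_mul, mul_pow]

lemma normSq_mono {f g : ℂ → ℂ} (h : ∀ w ∈ Metric.ball (0 : ℂ) 1, ‖f w‖ ≤ ‖g w‖) :
    normSq f ≤ normSq g := by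
  refine lintegral_mono_ae (ae_area_of_forall fun w hw => ?_)
  have := h w hw
  gcongr

lemma hasSum_taylor {f : ℂ → ℂ} (hf : AnalyticOnNhd ℂ f (Metric.ball 0 1)) {w : ℂ}
    (hw : w ∈ Metric.ball (0 : ℂ) 1) :
    HasSum (fun n : ℕ => (iteratedDeriv n f 0 / n.factorial) * w ^ n) (f w) := by
  have h := Complex.hasSum_taylorSeries_on_ball hf.differentiableOn hw
  simp only [sub_zero, smul_eq_mul] at h
  have e : (fun n : ℕ => (iteratedDeriv n f 0 / n.factorial) * w ^ n) =
      fun n : ℕ => (n.factorial : ℂ)⁻¹ * (w ^ n * iteratedDeriv n f 0) := by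
    ext n
    ring
  rwa [e]

/-- Weighted Cauchy-Schwarz: after clearing denominators, the difference is the square of `‖x‖ * t -
‖y‖ * s`. -/
lemma norm_add_sq_le_of_weights (x y : ℂ) {s t : ℝ} (hs : 0 < s) (ht : 0 < t) :
    ‖x + y‖ ^ 2 / (s + t) ≤ ‖x‖ ^ 2 / s + ‖y‖ ^ 2 / t := by
  have h1 : ‖x + y‖ ^ 2 ≤ (‖x‖ + ‖y‖) ^ 2 := by gcongr; exact norm_add_le x y
  have h3 : (‖x‖ + ‖y‖) ^ 2 / (s + t) ≤ ‖x‖ ^ 2 / s + ‖y‖ ^ 2 / t := by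
    rw [div_add_div _ _ hs.ne' ht.ne', div_le_div_iff₀ (by positivity) (by positivity)]
    nlinarith [sq_nonneg (‖x‖ * t - ‖y‖ * s)]
  exact le_trans (by gcongr) h3

lemma hasSum_mul_shift {f : ℂ → ℂ} {c : ℕ → ℂ} {w : ℂ} (h : HasSum (fun n => c n * w ^ n) (f w)) :
    HasSum (fun n => (if n = 0 then 0 else c (n - 1)) * w ^ n) (w * f w) := by
  rw [← hasSum_nat_add_iff' 1]
  have e : (fun n => (if n + 1 = 0 then 0 else c (n + 1 - 1)) * w ^ (n + 1)) =
      fun n => w * (c n * w ^ n) := by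
    ext n
    simp only [Nat.add_eq_zero_iff, one_ne_zero, and_false, if_false, Nat.add_sub_cancel]
    ring
  rw [e, Finset.sum_range_one, if_pos rfl, zero_mul, sub_zero]
  exact h.mul_left w

/-- Shimorin's inequality for the Bergman shift. -/
lemma normSq_add_mul_le {F G : ℂ → ℂ} (hF : AnalyticOnNhd ℂ F (Metric.ball 0 1))
    (hG : AnalyticOnNhd ℂ G (Metric.ball 0 1)) :
    normSq (fun w => F w + w * G w) ≤ 2 * (normSq (fun w => w * F w) + normSq G) := by
  obtain ⟨a, ha⟩ : ∃ a : ℕ → ℂ, ∀ w ∈ Metric.ball (0 : ℂ) 1,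
    HasSum (fun n => a n * w ^ n) (F w) := ⟨_, fun w hw => hasSum_taylor hF hw⟩
  obtain ⟨b, hb⟩ : ∃ b : ℕ → ℂ, ∀ w ∈ Metric.ball (0 : ℂ) 1,
    HasSum (fun n => b n * w ^ n) (G w) := ⟨_, fun w hw => hasSum_taylor hG hw⟩
  have hs : ∀ w ∈ Metric.ball (0 : ℂ) 1,
      HasSum (fun n => (a n + if n = 0 then 0 else b (n - 1)) * w ^ n) (F w + w * G w) := by
    intro w hw
    simp_rw [add_mul]
    exact (ha w hw).add (hasSum_mul_shift (hb w hw))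
  rw [normSq, normSq, normSq, lintegral_normSq_eq_tsum hs,
    lintegral_normSq_eq_tsum (fun w hw => hasSum_mul_shift (ha w hw)),
    lintegral_normSq_eq_tsum hb]
  rw [tsum_eq_zero_add' (f := fun n => ENNReal.ofReal
      (‖a n + if n = 0 then 0 else b (n - 1)‖ ^ 2 / (n + 1))) ENNReal.summable,
    tsum_eq_zero_add' (f := fun n => ENNReal.ofReal
      (‖if n = 0 then 0 else a (n - 1)‖ ^ 2 / (n + 1))) ENNReal.summable]
  rw [tsum_eq_zero_add' (f := fun n => ENNReal.ofReal
      (‖if n + 1 = 0 then 0 else a (n + 1 - 1)‖ ^ 2 / ((n + 1 : ℕ) + 1))) ENNReal.summable]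
  simp only [Nat.add_eq_zero_iff, one_ne_zero, and_false, if_false, Nat.add_sub_cancel, if_true,
    add_zero, norm_zero]
  -- The constant term is an equality: its weight is 1 on the left and 1/2 in the norm of `w * F w`.
  have head : ENNReal.ofReal (‖a 0‖ ^ 2 / ((0 : ℕ) + 1)) ≤
      2 * ENNReal.ofReal (‖a 0‖ ^ 2 / ((0 + 1 : ℕ) + 1)) := by
    rw [← ENNReal.ofReal_ofNat 2, ← ENNReal.ofReal_mul (by norm_num)]
    apply ENNReal.ofReal_le_ofReal
    push_cast
    linarith
  have tail : ∑' n : ℕ, ENNReal.ofReal (‖a (n + 1) + b n‖ ^ 2 / ((n + 1 : ℕ) + 1)) ≤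
      2 * (∑' n : ℕ, ENNReal.ofReal (‖a (n + 1)‖ ^ 2 / ((n + 1 + 1 : ℕ) + 1)) +
        ∑' n : ℕ, ENNReal.ofReal (‖b n‖ ^ 2 / (n + 1))) := by
    rw [← ENNReal.tsum_add, ← ENNReal.tsum_mul_left]
    refine ENNReal.tsum_le_tsum fun n => ?_
    rw [← ENNReal.ofReal_add (by positivity) (by positivity), ← ENNReal.ofReal_ofNat 2,
      ← ENNReal.ofReal_mul (by norm_num)]
    apply ENNReal.ofReal_le_ofReal
    -- The weight `n + 2` of the coefficient on the left is the mean of the weights `n + 3` and `n +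
    -- 1` on the right; this is where the factor 2 comes from.
    have h := norm_add_sq_le_of_weights (a (n + 1)) (b n) (s := (n + 1 + 1 : ℕ) + 1) (t := n + 1)
      (by positivity) (by positivity)
    have e : ‖a (n + 1) + b n‖ ^ 2 / (((n + 1 : ℕ) : ℝ) + 1) =
        2 * (‖a (n + 1) + b n‖ ^ 2 / (((n + 1 + 1 : ℕ) : ℝ) + 1 + (n + 1))) := by
      push_cast
      field_simp
      ring
    rw [e]
    gcongr
  refine (add_le_add head tail).trans_eq ?_
  simp
  ring

/-! ### Invariance under the automorphisms of the disc -/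

/-- The involution of the disc that exchanges `a` and `0`. -/
noncomputable def involution (a w : ℂ) : ℂ := (a - w) / (1 - conj a * w)

lemma one_sub_conj_mul_ne_zero {a w : ℂ} (ha : a ∈ Metric.ball (0 : ℂ) 1)
    (hw : w ∈ Metric.ball (0 : ℂ) 1) : 1 - conj a * w ≠ 0 := by
  rw [mem_ball_zero_iff] at ha hw
  intro h
  have h1 : ‖conj a * w‖ = 1 := by rw [← sub_eq_zero.1 h, norm_one]
  rw [norm_mul, Complex.norm_conj] at h1
  nlinarith [norm_nonneg a, norm_nonneg w]

lemma normSq_one_sub_sub (a w : ℂ) : ‖1 - conj a * w‖ ^ 2 - ‖a - w‖ ^ 2 =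
    (1 - ‖a‖ ^ 2) * (1 - ‖w‖ ^ 2) := by
  simp only [← Complex.normSq_eq_norm_sq, Complex.normSq_apply, Complex.sub_re, Complex.sub_im,
    Complex.mul_re, Complex.mul_im, Complex.conj_re, Complex.conj_im, Complex.one_re,
    Complex.one_im]
  ring

lemma involution_mem_ball {a w : ℂ} (ha : a ∈ Metric.ball (0 : ℂ) 1)
    (hw : w ∈ Metric.ball (0 : ℂ) 1) : involution a w ∈ Metric.ball (0 : ℂ) 1 := by
  have h0 := norm_pos_iff.2 (one_sub_conj_mul_ne_zero ha hw)
  rw [mem_ball_zero_iff] at ha hw ⊢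
  rw [involution, norm_div, div_lt_one h0]
  have h := normSq_one_sub_sub a w
  have h2 : 0 < (1 - ‖a‖ ^ 2) * (1 - ‖w‖ ^ 2) := by
    apply mul_pos <;> nlinarith [norm_nonneg a, norm_nonneg w]
  nlinarith [norm_nonneg (a - w)]

lemma one_sub_conj_mul_involution {a w : ℂ} (ha : a ∈ Metric.ball (0 : ℂ) 1)
    (hw : w ∈ Metric.ball (0 : ℂ) 1) :
    1 - conj a * involution a w = (1 - conj a * a) / (1 - conj a * w) := by
  have h0 := one_sub_conj_mul_ne_zero ha hw
  rw [involution]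
  field_simp
  ring

lemma involution_involution {a w : ℂ} (ha : a ∈ Metric.ball (0 : ℂ) 1)
    (hw : w ∈ Metric.ball (0 : ℂ) 1) : involution a (involution a w) = w := by
  have h0 := one_sub_conj_mul_ne_zero ha hw
  have h1 := one_sub_conj_mul_ne_zero ha ha
  rw [involution, one_sub_conj_mul_involution ha hw, div_div_eq_mul_div, div_eq_iff h1, involution,
    sub_mul, div_mul_cancel₀ _ h0]
  ring

lemma hasDerivAt_involution {a w : ℂ} (ha : a ∈ Metric.ball (0 : ℂ) 1)
    (hw : w ∈ Metric.ball (0 : ℂ) 1) :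
    HasDerivAt (involution a) (-(1 - conj a * a) / (1 - conj a * w) ^ 2) w := by
  have h0 := one_sub_conj_mul_ne_zero ha hw
  have h := ((hasDerivAt_id w).const_sub a).div
    (((hasDerivAt_id w).const_mul (conj a)).const_sub 1) h0
  convert! h using 1
  simp only [id]
  field_simp
  ring

lemma analyticOnNhd_involution {a : ℂ} (ha : a ∈ Metric.ball (0 : ℂ) 1) :
    AnalyticOnNhd ℂ (involution a) (Metric.ball 0 1) := fun w hw =>
  AnalyticAt.div (by fun_prop) (by fun_prop) (one_sub_conj_mul_ne_zero ha hw)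

lemma lintegral_ball_comp {φ φ' : ℂ → ℂ} {s : Set ℂ} (hs : MeasurableSet s)
    (hφ : ∀ w ∈ s, HasDerivAt φ (φ' w) w) (hinj : Set.InjOn φ s) (F : ℂ → ℝ≥0∞) :
    ∫⁻ w in φ '' s, F w = ∫⁻ w in s, ENNReal.ofReal (‖φ' w‖ ^ 2) * F (φ w) := by
  rw [lintegral_image_eq_lintegral_abs_det_fderiv_mul volume hs
    (fun w hw => ((hφ w hw).hasFDerivAt.restrictScalars ℝ).hasFDerivWithinAt) hinj]
  congr 1
  ext w
  congr 2
  -- Multiplication by a complex number has real determinant equal to its squared modulus.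
  simp [ContinuousLinearMap.det, LinearMap.det_restrictScalars, Algebra.norm_complex_eq,
    Complex.normSq_eq_norm_sq]

/-- Composition with the involution, with the weight that makes it isometric in `A^2`. -/
lemma normSq_comp_involution {a : ℂ} (ha : a ∈ Metric.ball (0 : ℂ) 1) (f : ℂ → ℂ) :
    normSq f = normSq (fun w => (1 - conj a * a) / (1 - conj a * w) ^ 2 * f (involution a w)) := by
  have himg : involution a '' Metric.ball 0 1 = Metric.ball 0 1 := by
    refine Set.Subset.antisymm (Set.image_subset_iff.2 fun w hw => involution_mem_ball ha hw)
      fun w hw => ⟨_, involution_mem_ball ha hw, involution_involution ha hw⟩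
  have hinj : Set.InjOn (involution a) (Metric.ball 0 1) := fun w hw v hv h => by
    rw [← involution_involution ha hw, h, involution_involution ha hv]
  rw [normSq, normSq, lintegral_area, lintegral_area]
  nth_rw 1 [← himg]
  rw [lintegral_ball_comp measurableSet_ball (fun w hw => hasDerivAt_involution ha hw) hinj]
  congr 1
  refine lintegral_congr fun w => ?_
  rw [← ENNReal.ofReal_mul (by positivity), neg_div, norm_neg, norm_mul, mul_pow]

/-- The weighted composition with the involution is isometric and turns multiplication by the
involution into multiplication by `w`, so this is Shimorin's inequality transported from 0 to `a`.
-/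
lemma normSq_add_involution_mul_le {a : ℂ} (ha : a ∈ Metric.ball (0 : ℂ) 1) {F G : ℂ → ℂ}
    (hF : AnalyticOnNhd ℂ F (Metric.ball 0 1)) (hG : AnalyticOnNhd ℂ G (Metric.ball 0 1)) :
    normSq (fun w => F w + involution a w * G w) ≤
      2 * (normSq (fun w => involution a w * F w) + normSq G) := by
  have key : ∀ {f : ℂ → ℂ}, AnalyticOnNhd ℂ f (Metric.ball 0 1) → AnalyticOnNhd ℂ
      (fun w => (1 - conj a * a) / (1 - conj a * w) ^ 2 * f (involution a w))
      (Metric.ball 0 1) := by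
    intro f hf w hw
    refine AnalyticAt.mul (AnalyticAt.div (by fun_prop) (by fun_prop)
      (pow_ne_zero 2 (one_sub_conj_mul_ne_zero ha hw))) ?_
    exact (hf _ (involution_mem_ball ha hw)).comp (analyticOnNhd_involution ha w hw)
  have h := normSq_add_mul_le (key hF) (key hG)
  rw [normSq_comp_involution ha G, normSq_comp_involution ha (fun w => F w + involution a w * G w),
    normSq_comp_involution ha (fun w => involution a w * F w)]
  convert h using 1
  · refine normSq_congr fun w hw => ?_
    simp only [involution_involution ha hw]
    ring
  · congr 2
    refine normSq_congr fun w hw => ?_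
    simp only [involution_involution ha hw]
    ring

/-- Up to a constant, `φ * (2 - conj a * φ)` with `φ` the involution of `a` is the divisor of the
single zero `a` in `A^2`, and multiplication by this divisor does not decrease norms. -/
lemma normSq_le_normSq_singleDivisor_mul {a : ℂ} (ha : a ∈ Metric.ball (0 : ℂ) 1) {f : ℂ → ℂ}
    (hf : AnalyticOnNhd ℂ f (Metric.ball 0 1)) :
    ENNReal.ofReal (2 - ‖a‖ ^ 2) * normSq f ≤
      normSq (fun w => involution a w * (2 - conj a * involution a w) * f w) := by
  have hφ := analyticOnNhd_involution ha
  have ha1 : ‖a‖ < 1 := by simpa using ha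
  set F : ℂ → ℂ := fun w => (2 - conj a * involution a w) * f w with hFdef
  have hF : AnalyticOnNhd ℂ F (Metric.ball 0 1) := fun w hw => by
    have := hφ w hw
    have := hf w hw
    fun_prop
  have e1 : (fun w => involution a w * (2 - conj a * involution a w) * f w) =
      fun w => involution a w * F w := by
    ext w
    simp only [hFdef]
    ring
  rw [e1]
  by_cases htop : normSq (fun w => involution a w * F w) = ∞
  · rw [htop]
    exact le_top
  have hle : normSq f ≤ normSq F := normSq_mono fun w hw => by
    have h1 : ‖conj a * involution a w‖ ≤ 1 := by
      rw [norm_mul, Complex.norm_conj]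
      have := involution_mem_ball ha hw
      rw [mem_ball_zero_iff] at this
      exact mul_le_one₀ ha1.le (norm_nonneg _) this.le
    have h2 : 1 ≤ ‖2 - conj a * involution a w‖ := by
      have := norm_sub_norm_le (2 : ℂ) (conj a * involution a w)
      rw [Complex.norm_ofNat] at this
      linarith
    rw [hFdef, norm_mul]
    exact le_mul_of_one_le_left (norm_nonneg _) h2
  -- With `G = 0` the inequality shows that `f` has finite norm, which the subtraction below needs.
  have h1 := normSq_add_involution_mul_le ha hF (G := fun _ => 0) (fun _ _ => analyticAt_const)
  have hfin : normSq f ≠ ∞ := by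
    refine ne_top_of_le_ne_top ?_ (hle.trans ?_) (b := 2 * normSq (fun w => involution a w * F w))
    · exact ENNReal.mul_ne_top (by norm_num) htop
    · simpa [normSq] using h1
  -- This `G` cancels the variable part of `F`, leaving `2 * f`. The result is `4‖f‖² ≤ 2(‖φF‖² +
  -- |a|²‖f‖²)`, with `φ` the involution, which rearranges to the claim.
  have h2 := normSq_add_involution_mul_le ha hF (G := fun w => conj a * f w)
    (fun w hw => by have := hf w hw; fun_prop)
  have e2 : (fun w => F w + involution a w * (conj a * f w)) = fun w => 2 * f w := by
    ext w
    simp only [hFdef]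
    ring
  rw [e2, normSq_const_mul, normSq_const_mul, Complex.norm_conj, Complex.norm_ofNat] at h2
  generalize normSq (fun w => involution a w * F w) = X at *
  generalize normSq f = Y at *
  lift X to NNReal using htop
  lift Y to NNReal using hfin
  rw [← ENNReal.ofReal_coe_nnreal, ← ENNReal.ofReal_coe_nnreal,
    ← ENNReal.ofReal_mul (by nlinarith [norm_nonneg a])]
  rw [← ENNReal.ofReal_coe_nnreal, ← ENNReal.ofReal_coe_nnreal, ← ENNReal.ofReal_mul (by positivity),
    ← ENNReal.ofReal_mul (by positivity), ← ENNReal.ofReal_add (by positivity) (by positivity),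
    ← ENNReal.ofReal_ofNat 2, ← ENNReal.ofReal_mul (by positivity),
    ENNReal.ofReal_le_ofReal_iff (by positivity)] at h2
  apply ENNReal.ofReal_le_ofReal
  linarith


/-! ### The reproducing kernel and its derivatives -/

/-- Up to a constant, the function that represents the `j`-th derivative at `a` in `A^2`. -/
noncomputable def kernel (a : ℂ) (j : ℕ) (w : ℂ) : ℂ := w ^ j / (1 - conj a * w) ^ (j + 2)

lemma analyticOnNhd_kernel {a : ℂ} (ha : a ∈ Metric.ball (0 : ℂ) 1) (j : ℕ) :
    AnalyticOnNhd ℂ (kernel a j) (Metric.ball 0 1) := fun w hw =>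
  AnalyticAt.div (by fun_prop) (by fun_prop)
    (pow_ne_zero _ (one_sub_conj_mul_ne_zero ha hw))

lemma one_sub_norm_le_norm_one_sub_conj_mul (a : ℂ) {w : ℂ} (hw : w ∈ Metric.ball (0 : ℂ) 1) :
    1 - ‖a‖ ≤ ‖1 - conj a * w‖ := by
  have hw1 : ‖w‖ < 1 := by simpa using hw
  have h := norm_sub_norm_le (1 : ℂ) (conj a * w)
  rw [norm_one, norm_mul, Complex.norm_conj] at h
  nlinarith [norm_nonneg a]

lemma norm_kernel_le {a w : ℂ} (ha : a ∈ Metric.ball (0 : ℂ) 1)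
    (hw : w ∈ Metric.ball (0 : ℂ) 1) (j : ℕ) :
    ‖kernel a j w‖ ≤ ((1 - ‖a‖) ^ (j + 2))⁻¹ := by
  have ha1 : 0 < 1 - ‖a‖ := by simpa using ha
  have hw1 : ‖w‖ < 1 := by simpa using hw
  rw [kernel, norm_div, norm_pow, norm_pow, inv_eq_one_div]
  have := one_sub_norm_le_norm_one_sub_conj_mul a hw
  gcongr
  exact pow_le_one₀ (norm_nonneg w) hw1.le

lemma memLp_of_bounded {f : ℂ → ℂ} (hf : ContinuousOn f (Metric.ball 0 1)) {C : ℝ}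
    (hC : ∀ w ∈ Metric.ball (0 : ℂ) 1, ‖f w‖ ≤ C) (p : ℝ≥0∞) : MemLp f p area :=
  MemLp.of_bound (aestronglyMeasurable_area hf) C (ae_area_of_forall hC)

lemma memLp_kernel {a : ℂ} (ha : a ∈ Metric.ball (0 : ℂ) 1) (j : ℕ) (p : ℝ≥0∞) :
    MemLp (kernel a j) p area :=
  memLp_of_bounded (analyticOnNhd_kernel ha j).continuousOn (fun _ hw => norm_kernel_le ha hw j) p

lemma integrable_conj_mul {f g : ℂ → ℂ} (hf : MemLp f 2 area) (hg : MemLp g 2 area) :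
    Integrable (fun w => conj (f w) * g w) area :=
  MemLp.integrable_mul (p := 2) (q := 2) hf.star hg

lemma hasSum_integral_normSq {f : ℂ → ℂ} (hf : MemLp f 2 area) {a : ℕ → ℂ}
    (h : ∀ w ∈ Metric.ball (0 : ℂ) 1, HasSum (fun n => a n * w ^ n) (f w)) :
    HasSum (fun n => ‖a n‖ ^ 2 / (n + 1)) (∫ w, ‖f w‖ ^ 2 ∂area) := by
  have h1 := lintegral_normSq_eq_tsum h
  have h2 : Integrable (fun w => ‖f w‖ ^ 2) area :=
    (memLp_two_iff_integrable_sq_norm hf.1).1 hf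
  rw [← ofReal_integral_eq_lintegral_ofReal h2
    (Filter.Eventually.of_forall fun w => by positivity)] at h1
  have h3 : ∀ n, 0 ≤ ‖a n‖ ^ 2 / ((n : ℝ) + 1) := fun n => by positivity
  have hs : Summable fun n => ‖a n‖ ^ 2 / ((n : ℝ) + 1) := by
    have : ∑' n, ENNReal.ofReal (‖a n‖ ^ 2 / (n + 1)) ≠ ∞ := h1 ▸ ENNReal.ofReal_ne_top
    simpa [ENNReal.toReal_ofReal (h3 _)] using ENNReal.summable_toReal this
  rw [← ENNReal.ofReal_tsum_of_nonneg h3 hs, ENNReal.ofReal_eq_ofReal_iff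
    (integral_nonneg fun w => by positivity) (tsum_nonneg h3)] at h1
  rw [h1]
  exact hs.hasSum

lemma hasSum_kernel_zero {a w : ℂ} (ha : a ∈ Metric.ball (0 : ℂ) 1)
    (hw : w ∈ Metric.ball (0 : ℂ) 1) :
    HasSum (fun n : ℕ => ((n + 1 : ℂ) * conj a ^ n) * w ^ n) (kernel a 0 w) := by
  have h : ‖conj a * w‖ < 1 := by
    rw [norm_mul, Complex.norm_conj]
    rw [mem_ball_zero_iff] at ha hw
    nlinarith [norm_nonneg a, norm_nonneg w]
  have h1 := hasSum_choose_mul_geometric_of_norm_lt_one 1 h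
  simp only [kernel, pow_zero]
  have e : (fun n : ℕ => ((n + 1 : ℂ) * conj a ^ n) * w ^ n) =
      fun n : ℕ => ((n + 1).choose 1 : ℂ) * (conj a * w) ^ n := by
    ext n
    rw [Nat.choose_one_right, mul_pow]
    push_cast
    ring
  rwa [e]

lemma norm_add_sq_sub_norm_sub_sq (x y : ℂ) :
    ‖x + y‖ ^ 2 - ‖x - y‖ ^ 2 = 4 * (conj y * x).re := by
  simp only [← Complex.normSq_eq_norm_sq, Complex.normSq_apply, Complex.sub_re, Complex.sub_im,
    Complex.mul_re, Complex.add_re, Complex.add_im, Complex.conj_re, Complex.conj_im]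
  ring

/-- The reproducing formula in `A^2`. -/
lemma integral_conj_kernel_zero_mul {a : ℂ} (ha : a ∈ Metric.ball (0 : ℂ) 1) {q : ℂ → ℂ}
    (hq : MemSpace 2 q) : ∫ w, conj (kernel a 0 w) * q w ∂area = q a := by
  have hk := memLp_kernel ha 0 2
  obtain ⟨c, hc⟩ : ∃ c : ℕ → ℂ, ∀ w ∈ Metric.ball (0 : ℂ) 1,
    HasSum (fun n => c n * w ^ n) (q w) := ⟨_, fun w hw => hasSum_taylor hq.analytic hw⟩
  -- Polarization: Parseval's formula for `q + t * kernel` and `q - t * kernel` is subtracted. The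
  -- values `t = 1` and `t = I` recover the real and imaginary parts.
  have key : ∀ t : ℂ, (conj t * ∫ w, conj (kernel a 0 w) * q w ∂area).re = (conj t * q a).re := by
    intro t
    have hs : ∀ s : ℂ, ∀ w ∈ Metric.ball (0 : ℂ) 1,
        HasSum (fun n : ℕ => (c n + s * ((n + 1 : ℂ) * conj a ^ n)) * w ^ n)
          (q w + s * kernel a 0 w) := by
      intro s w hw
      convert! (hc w hw).add ((hasSum_kernel_zero ha hw).mul_left s) using 2 with n
      ring
    have hL : ∀ s : ℂ, MemLp (fun w => q w + s * kernel a 0 w) 2 area := fun s =>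
      hq.memLp.add (hk.const_mul s)
    have h1 := (hasSum_integral_normSq (hL t) (hs t)).sub
      (hasSum_integral_normSq (hL (-t)) (hs (-t)))
    rw [← integral_sub ((memLp_two_iff_integrable_sq_norm (hL t).1).1 (hL t))
      ((memLp_two_iff_integrable_sq_norm (hL (-t)).1).1 (hL (-t)))] at h1
    simp only [neg_mul, ← sub_eq_add_neg, norm_add_sq_sub_norm_sub_sq, ← sub_div] at h1
    have h2 : ∫ w, 4 * (conj (t * kernel a 0 w) * q w).re ∂area =
        4 * (conj t * ∫ w, conj (kernel a 0 w) * q w ∂area).re := by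
      rw [integral_const_mul, ← integral_const_mul (conj t)]
      congr 1
      rw [← RCLike.re_eq_complex_re, ← integral_re]
      · simp only [map_mul, mul_assoc]
      · exact (integrable_conj_mul hk hq.memLp).const_mul _
    have h3 : HasSum (fun n : ℕ => 4 * (conj (t * ((n + 1 : ℂ) * conj a ^ n)) * c n).re / (n + 1))
        (4 * (conj t * q a).re) := by
      have h := (Complex.hasSum_re ((hc a ha).mul_left (conj t))).mul_left 4
      convert! h using 2 with n
      have e : conj (t * ((n + 1 : ℂ) * conj a ^ n)) * c n =
          ((n + 1 : ℝ) : ℂ) * (conj t * (c n * a ^ n)) := by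
        simp only [map_mul, map_add, map_pow, Complex.conj_conj, map_one, Complex.conj_natCast]
        push_cast
        ring
      rw [e, Complex.re_ofReal_mul]
      have : (n + 1 : ℝ) ≠ 0 := by positivity
      field_simp
    rw [h2] at h1
    have := h1.unique h3
    linarith
  apply Complex.ext
  · simpa using key 1
  · simpa using key Complex.I

/-- With `x = t * conj w / (1 - a * conj w)`, the denominator at `a + t` is `(1 - a * conj w) * (1 -
x)`, and the series is that of `(1 - x)⁻²`. Integrated against `q`, it yields the Taylor series of
`q` at `a`. -/
lemma hasSum_kernel_zero_add {a t w : ℂ} (ha : a ∈ Metric.ball (0 : ℂ) 1)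
    (hw : w ∈ Metric.ball (0 : ℂ) 1) (ht : ‖t‖ < 1 - ‖a‖) :
    HasSum (fun j : ℕ => t ^ j * ((j + 1 : ℂ) * conj (kernel a j w)))
      (conj (kernel (a + t) 0 w)) := by
  have h0 : 1 - conj a * w ≠ 0 := one_sub_conj_mul_ne_zero ha hw
  have h0' : 1 - a * conj w ≠ 0 := by
    intro h
    apply h0
    rw [← map_eq_zero (starRingEnd ℂ)]
    simpa using h
  have hb := one_sub_norm_le_norm_one_sub_conj_mul a hw
  have hw1 : ‖w‖ < 1 := by simpa using hw
  have hx : ‖t * conj w / (1 - a * conj w)‖ < 1 := by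
    have e : ‖1 - a * conj w‖ = ‖1 - conj a * w‖ := by
      rw [← Complex.norm_conj]
      simp
    rw [norm_div, e, norm_mul, Complex.norm_conj, div_lt_one (norm_pos_iff.2 h0)]
    nlinarith [norm_nonneg t, norm_nonneg w]
  have h := (hasSum_choose_mul_geometric_of_norm_lt_one 1 hx).mul_left (1 / (1 - a * conj w) ^ 2)
  have h1 : 1 - t * conj w / (1 - a * conj w) ≠ 0 := by
    intro h
    rw [sub_eq_zero] at h
    rw [← h, norm_one] at hx
    exact lt_irrefl _ hx
  have h2 : 1 - (a + t) * conj w = (1 - t * conj w / (1 - a * conj w)) * (1 - a * conj w) := by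
    rw [sub_mul, div_mul_cancel₀ _ h0']
    ring
  convert! h using 1
  · ext j
    simp only [kernel, map_div₀, map_pow, map_sub, map_mul, map_one, Complex.conj_conj,
      Nat.choose_one_right, div_pow, mul_pow]
    push_cast
    field_simp
    ring
  · simp only [kernel, map_div₀, map_pow, map_sub, map_mul, map_one, Complex.conj_conj, pow_zero]
    rw [h2, mul_pow, zero_add, one_div_mul_one_div, mul_comm]

lemma iteratedDeriv_eq_of_hasSum {q : ℂ → ℂ} {a : ℂ} (hq : AnalyticAt ℂ q a) {c : ℕ → ℂ}
    (h : ∀ᶠ t in nhds 0, HasSum (fun j : ℕ => t ^ j * c j) (q (a + t))) (j : ℕ) :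
    iteratedDeriv j q a = j.factorial * c j := by
  have h1 : HasFPowerSeriesAt q (FormalMultilinearSeries.ofScalars ℂ c) a := by
    rw [hasFPowerSeriesAt_iff]
    simpa only [FormalMultilinearSeries.coeff_ofScalars, smul_eq_mul] using h
  have h2 := congrFun (FormalMultilinearSeries.ofScalars_series_injective ℂ ℂ
    (hq.hasFPowerSeriesAt.eq_formalMultilinearSeries h1)) j
  have : (j.factorial : ℂ) ≠ 0 := by exact_mod_cast j.factorial_ne_zero
  rw [← h2]
  field_simp

lemma iteratedDeriv_eq_integral {a : ℂ} (ha : a ∈ Metric.ball (0 : ℂ) 1) {q : ℂ → ℂ}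
    (hq : MemSpace 2 q) (j : ℕ) :
    iteratedDeriv j q a = (j + 1).factorial * ∫ w, conj (kernel a j w) * q w ∂area := by
  have ha1 : 0 < 1 - ‖a‖ := by simpa using ha
  rw [Nat.factorial_succ]
  have key := iteratedDeriv_eq_of_hasSum (hq.analytic a ha)
    (c := fun j => (j + 1) * ∫ w, conj (kernel a j w) * q w ∂area) ?_ j
  · rw [key]
    push_cast
    ring
  filter_upwards [Metric.ball_mem_nhds (0 : ℂ) ha1] with t ht
  rw [mem_ball_zero_iff] at ht
  have hat : a + t ∈ Metric.ball (0 : ℂ) 1 := by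
    rw [mem_ball_zero_iff]
    linarith [norm_add_le a t]
  have hqi : Integrable q area := hq.memLp.integrable (by norm_num)
  have hint : ∀ j : ℕ, Integrable
      (fun w => t ^ j * ((j + 1 : ℂ) * conj (kernel a j w)) * q w) area := fun j => by
    have h := (integrable_conj_mul (memLp_kernel ha j 2) hq.memLp).const_mul (t ^ j * (j + 1 : ℂ))
    convert h using 2 with w
    ring
  have hx : ‖(‖t‖ / (1 - ‖a‖) : ℝ)‖ < 1 := by
    rw [Real.norm_of_nonneg (by positivity), div_lt_one ha1]
    exact ht
  -- The uniform bound on the kernels dominates the series by a multiple of `∑ (j + 1) * (‖t‖ / (1 -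
  -- ‖a‖)) ^ j`, so sum and integral may be exchanged.
  have h := hasSum_integral_of_summable_integral_norm hint (by
    have hsum := ((hasSum_choose_mul_geometric_of_norm_lt_one 1 hx).summable).mul_right
      (((1 - ‖a‖) ^ 2)⁻¹ * ∫ w, ‖q w‖ ∂area)
    refine Summable.of_nonneg_of_le (fun j => integral_nonneg fun w => norm_nonneg _)
      (fun j => ?_) hsum
    rw [← mul_assoc, ← integral_const_mul]
    refine integral_mono_ae (hint j).norm (hqi.norm.const_mul _) (ae_area_of_forall fun w hw => ?_)
    simp only [norm_mul, norm_pow, Complex.norm_conj]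
    have e : ‖(j + 1 : ℂ)‖ = j + 1 := by
      rw [← Nat.cast_succ, Complex.norm_natCast]
      push_cast
      ring
    rw [e, Nat.choose_one_right]
    refine mul_le_mul_of_nonneg_right ?_ (norm_nonneg _)
    calc ‖t‖ ^ j * ((j + 1) * ‖kernel a j w‖)
        ≤ ‖t‖ ^ j * ((j + 1) * ((1 - ‖a‖) ^ (j + 2))⁻¹) := by
          gcongr
          exact norm_kernel_le ha hw j
      _ = _ := by
          rw [div_pow]
          push_cast
          field_simp
          ring)
  convert! h using 1
  · ext j
    rw [← integral_const_mul, ← integral_const_mul]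
    congr 1
    ext w
    ring
  · rw [← integral_conj_kernel_zero_mul hat hq]
    refine integral_congr_ae (ae_area_of_forall fun w hw => ?_)
    exact ((hasSum_kernel_zero_add ha hw ht).mul_right (q w)).tsum_eq.symm

/-- A function in `A^2` vanishes to order at least `K` at `a` if and only if it is orthogonal to
the first `K` kernels at `a`. -/
lemma le_analyticOrderAt_iff_orthogonal {a : ℂ} (ha : a ∈ Metric.ball (0 : ℂ) 1) {q : ℂ → ℂ}
    (hq : MemSpace 2 q) (K : ℕ) :
    (K : ℕ∞) ≤ analyticOrderAt q a ↔ ∀ j < K, ∫ w, conj (kernel a j w) * q w ∂area = 0 := by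
  rw [natCast_le_analyticOrderAt_iff_iteratedDeriv_eq_zero (hq.analytic a ha)]
  refine forall₂_congr fun j _ => ?_
  rw [iteratedDeriv_eq_integral ha hq, mul_eq_zero, or_iff_right]
  exact_mod_cast Nat.factorial_ne_zero _


/-! ### Zeros of analytic functions in the disc -/

lemma exists_eq_pow_mul_of_le_analyticOrderAt {f : ℂ → ℂ}
    (hf : AnalyticOnNhd ℂ f (Metric.ball 0 1)) {a : ℂ} (ha : a ∈ Metric.ball (0 : ℂ) 1) {K : ℕ}
    (hK : (K : ℕ∞) ≤ analyticOrderAt f a) :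
    ∃ u : ℂ → ℂ, AnalyticOnNhd ℂ u (Metric.ball 0 1) ∧
      ∀ w ∈ Metric.ball (0 : ℂ) 1, f w = (w - a) ^ K * u w := by
  induction K generalizing f with
  | zero => exact ⟨f, hf, fun w _ => by simp⟩
  | succ K ih =>
    have h0 : f a = 0 := apply_eq_zero_of_analyticOrderAt_ne_zero fun h => by simp [h] at hK
    have hd : AnalyticOnNhd ℂ (dslope f a) (Metric.ball 0 1) :=
      ((Complex.differentiableOn_dslope (Metric.isOpen_ball.mem_nhds ha)).2
        hf.differentiableOn).analyticOnNhd Metric.isOpen_ball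
    have he : f = (fun w => w - a) * dslope f a := by
      ext w
      rw [Pi.mul_apply, ← smul_eq_mul, sub_smul_dslope_of_zero h0]
    obtain ⟨u, hu, h⟩ := ih hd (by
      rw [he, analyticOrderAt_mul (by fun_prop) (hd a ha)] at hK
      have h1 : analyticOrderAt (fun w => w - a) a = 1 := analyticOrderAt_id_sub_const_self
      rw [h1, add_comm 1] at hK
      push_cast at hK
      exact (ENat.add_le_add_iff_right ENat.one_ne_top).1 hK)
    refine ⟨u, hu, fun w hw => ?_⟩
    rw [he, Pi.mul_apply, h w hw, pow_succ]
    ring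

lemma eventuallyEq_of_eqOn_ball {f g : ℂ → ℂ} (h : ∀ w ∈ Metric.ball (0 : ℂ) 1, f w = g w) {a : ℂ}
    (ha : a ∈ Metric.ball (0 : ℂ) 1) : f =ᶠ[nhds a] g :=
  Filter.eventuallyEq_of_mem (Metric.isOpen_ball.mem_nhds ha) h

lemma analyticOrderAt_eq_of_eq_mul {f v u : ℂ → ℂ} {a : ℂ}
    (ha : a ∈ Metric.ball (0 : ℂ) 1) (hv : AnalyticAt ℂ v a) (hva : v a ≠ 0)
    (hu : AnalyticAt ℂ u a) (h : ∀ w ∈ Metric.ball (0 : ℂ) 1, f w = v w * u w) :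
    analyticOrderAt f a = analyticOrderAt u a := by
  rw [analyticOrderAt_congr (eventuallyEq_of_eqOn_ball (g := v * u) h ha),
    analyticOrderAt_mul hv hu, (hv.analyticOrderAt_eq_zero).2 hva, zero_add]

/-- The points are divided out one at a time. The factors already removed do not vanish at the next
point, so the order of the quotient there is unchanged. -/
lemma exists_eq_prod_mul {ι : Type*} {f : ℂ → ℂ} (hf : AnalyticOnNhd ℂ f (Metric.ball 0 1))
    {z : ι → ℂ} {K : ι → ℕ} (hz : ∀ n, z n ∈ Metric.ball (0 : ℂ) 1)
    (hinj : Function.Injective z) (hK : ∀ n, (K n : ℕ∞) ≤ analyticOrderAt f (z n))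
    (s : Finset ι) :
    ∃ u : ℂ → ℂ, AnalyticOnNhd ℂ u (Metric.ball 0 1) ∧
      ∀ w ∈ Metric.ball (0 : ℂ) 1, f w = (∏ n ∈ s, (w - z n) ^ K n) * u w := by
  classical
  induction s using Finset.induction_on with
  | empty => exact ⟨f, hf, fun w _ => by simp⟩
  | insert i s hi ih =>
    obtain ⟨u, hu, h⟩ := ih
    have hord := analyticOrderAt_eq_of_eq_mul (v := fun w => ∏ n ∈ s, (w - z n) ^ K n) (hz i)
      (by fun_prop) (Finset.prod_ne_zero_iff.2 fun n hn => pow_ne_zero _ (sub_ne_zero.2 fun h =>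
        hi ((hinj h).symm ▸ hn))) (hu _ (hz i)) h
    obtain ⟨v, hv, h'⟩ := exists_eq_pow_mul_of_le_analyticOrderAt hu (hz i) (hord ▸ hK i)
    refine ⟨v, hv, fun w hw => ?_⟩
    rw [h w hw, h' w hw, Finset.prod_insert hi]
    ring

lemma iteratedDeriv_of_eq_pow_mul {f u : ℂ → ℂ} {m : ℕ} (hu : AnalyticAt ℂ u 0)
    (h : ∀ᶠ w in nhds 0, f w = w ^ m * u w) : iteratedDeriv m f 0 = m.factorial * u 0 := by
  induction m generalizing f u with
  | zero => simpa using h.self_of_nhds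
  | succ m ih =>
    have hd : ∀ᶠ w in nhds 0, deriv f w = w ^ m * ((m + 1) * u w + w * deriv u w) := by
      filter_upwards [h.eventually_nhds, hu.eventually_analyticAt] with w hw huw
      rw [Filter.EventuallyEq.deriv_eq hw]
      have := ((hasDerivAt_pow (m + 1) w).mul huw.differentiableAt.hasDerivAt).deriv
      rw [show (fun w => w ^ (m + 1) * u w) = (fun w => w ^ (m + 1)) * u from rfl, this]
      rw [Nat.add_sub_cancel]
      push_cast
      ring
    rw [iteratedDeriv_succ', ih _ hd]
    · rw [Nat.factorial_succ]
      push_cast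
      ring
    · have := hu.deriv
      fun_prop

/-! ### The functions of canonical form -/

/-- The functions in `L^2` that are orthogonal to `q`. -/
def orthogonalTo {q : ℂ → ℂ} (hq : MemLp q 2 area) : Submodule ℂ (ℂ → ℂ) where
  carrier := {h | MemLp h 2 area ∧ ∫ w, conj (h w) * q w ∂area = 0}
  zero_mem' := ⟨MemLp.zero, by simp⟩
  add_mem' := by
    rintro f g ⟨hf, hf'⟩ ⟨hg, hg'⟩
    refine ⟨hf.add hg, ?_⟩
    simp only [Pi.add_apply, map_add, add_mul]
    rw [integral_add (integrable_conj_mul hf hq) (integrable_conj_mul hg hq), hf', hg', add_zero]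
  smul_mem' := by
    rintro c f ⟨hf, hf'⟩
    refine ⟨hf.const_smul c, ?_⟩
    simp only [Pi.smul_apply, smul_eq_mul, map_mul, mul_assoc]
    rw [integral_const_mul, hf', mul_zero]

/-- Binomial expansion of `1 = (conj a * w + (1 - conj a * w)) ^ j`. Together with the reverse
expansion `conj_pow_mul_kernel_eq_sum`, it shows that for `a ≠ 0` the first `K` kernels and the
first `K` fractions span the same functions in the disc. -/
lemma one_div_pow_eq_sum_kernel {a w : ℂ} (ha : a ∈ Metric.ball (0 : ℂ) 1)
    (hw : w ∈ Metric.ball (0 : ℂ) 1) (j : ℕ) :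
    1 / (1 - conj a * w) ^ (j + 2) =
      ∑ i ∈ Finset.range (j + 1), (j.choose i * conj a ^ i) * kernel a i w := by
  have h0 := one_sub_conj_mul_ne_zero ha hw
  have h := add_pow (conj a * w) (1 - conj a * w) j
  rw [add_sub_cancel, one_pow] at h
  nth_rw 1 [h]
  rw [Finset.sum_div]
  refine Finset.sum_congr rfl fun i hi => ?_
  have hi' : i ≤ j := Nat.lt_succ_iff.1 (Finset.mem_range.1 hi)
  have e : (1 - conj a * w) ^ (j + 2) = (1 - conj a * w) ^ (j - i) * (1 - conj a * w) ^ (i + 2) := by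
    rw [← pow_add]
    congr 1
    omega
  rw [e, kernel, mul_pow]
  field_simp

lemma conj_pow_mul_kernel_eq_sum {a w : ℂ} (ha : a ∈ Metric.ball (0 : ℂ) 1)
    (hw : w ∈ Metric.ball (0 : ℂ) 1) (j : ℕ) :
    conj a ^ j * kernel a j w =
      ∑ i ∈ Finset.range (j + 1), ((-1) ^ (j - i) * j.choose i) / (1 - conj a * w) ^ (i + 2) := by
  have h0 := one_sub_conj_mul_ne_zero ha hw
  have h := add_pow 1 (-(1 - conj a * w)) j
  rw [← sub_eq_add_neg, sub_sub_cancel] at h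
  rw [kernel, ← mul_div_assoc, ← mul_pow, h, Finset.sum_div]
  refine Finset.sum_congr rfl fun i hi => ?_
  have hi' : i ≤ j := Nat.lt_succ_iff.1 (Finset.mem_range.1 hi)
  have e : (1 - conj a * w) ^ (j + 2) = (1 - conj a * w) ^ (j - i) * (1 - conj a * w) ^ (i + 2) := by
    rw [← pow_add]
    congr 1
    omega
  rw [e, one_pow, neg_pow]
  field_simp

lemma kernel_zero_left (j : ℕ) (w : ℂ) : kernel 0 j w = w ^ j := by
  simp [kernel]

lemma orderAtOrigin_of_forall_ne {N : ℕ} {z : Fin N → ℂ} (d : Fin N → ℕ) (h : ∀ n, z n ≠ 0) :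
    orderAtOrigin z d = 0 := by
  simp [orderAtOrigin, h]

lemma orderAtOrigin_of_eq {N : ℕ} {z : Fin N → ℂ} (d : Fin N → ℕ) (hinj : Function.Injective z)
    {i : Fin N} (h : z i = 0) : orderAtOrigin z d = d i := by
  classical
  rw [orderAtOrigin, Finset.sum_eq_single i]
  · simp [h]
  · intro n _ hn
    rw [if_neg]
    rw [← h]
    exact fun h' => hn (hinj h')
  · simp

/-- The building blocks of the canonical form. -/
noncomputable def fraction (a : ℂ) (j : ℕ) (w : ℂ) : ℂ :=
  open Classical in if a = 0 then w ^ j else 1 / (1 - conj a * w) ^ (j + 2)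

lemma fraction_zero (j : ℕ) (w : ℂ) : fraction 0 j w = w ^ j := if_pos rfl

lemma fraction_of_ne {a : ℂ} (ha : a ≠ 0) (j : ℕ) (w : ℂ) :
    fraction a j w = 1 / (1 - conj a * w) ^ (j + 2) := if_neg ha

lemma analyticOnNhd_fraction {a : ℂ} (ha : a ∈ Metric.ball (0 : ℂ) 1) (j : ℕ) :
    AnalyticOnNhd ℂ (fraction a j) (Metric.ball 0 1) := by
  rcases eq_or_ne a 0 with rfl | h
  · have : fraction 0 j = fun w => w ^ j := funext (fraction_zero j)
    rw [this]
    exact fun w _ => by fun_prop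
  · have : fraction a j = fun w => 1 / (1 - conj a * w) ^ (j + 2) := funext (fraction_of_ne h j)
    rw [this]
    exact fun w hw => AnalyticAt.div (by fun_prop) (by fun_prop)
      (pow_ne_zero _ (one_sub_conj_mul_ne_zero ha hw))

lemma norm_fraction_le {a w : ℂ} (ha : a ∈ Metric.ball (0 : ℂ) 1)
    (hw : w ∈ Metric.ball (0 : ℂ) 1) (j : ℕ) :
    ‖fraction a j w‖ ≤ ((1 - ‖a‖) ^ (j + 2))⁻¹ := by
  rcases eq_or_ne a 0 with rfl | h
  · have hw1 : ‖w‖ < 1 := by simpa using hw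
    simpa [fraction_zero] using pow_le_one₀ (norm_nonneg w) hw1.le
  · have ha1 : 0 < 1 - ‖a‖ := by simpa using ha
    rw [fraction_of_ne h, norm_div, norm_pow, norm_one, inv_eq_one_div]
    have := one_sub_norm_le_norm_one_sub_conj_mul a hw
    gcongr

/-- The span of the building blocks. -/
def fractionSpan {N : ℕ} (z : Fin N → ℂ) (K : Fin N → ℕ) : Submodule ℂ (ℂ → ℂ) :=
  Submodule.span ℂ (Set.range fun p : Σ n, Fin (K n) => fraction (z p.1) p.2)

instance {N : ℕ} (z : Fin N → ℂ) (K : Fin N → ℕ) : FiniteDimensional ℂ (fractionSpan z K) :=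
  FiniteDimensional.span_of_finite ℂ (Set.finite_range _)

lemma fraction_mem_fractionSpan {N : ℕ} (z : Fin N → ℂ) {K : Fin N → ℕ} {n : Fin N} {j : ℕ}
    (hj : j < K n) : fraction (z n) j ∈ fractionSpan z K :=
  Submodule.subset_span ⟨⟨n, ⟨j, hj⟩⟩, rfl⟩

lemma exists_eq_sum_of_mem_fractionSpan {N : ℕ} {z : Fin N → ℂ} {K : Fin N → ℕ} {r : ℂ → ℂ}
    (hr : r ∈ fractionSpan z K) : ∃ c : Fin N → ℕ → ℂ, ∀ w,
      r w = ∑ n, ∑ j ∈ Finset.range (K n), c n j * fraction (z n) j w := by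
  obtain ⟨c, hc⟩ := (Submodule.mem_span_range_iff_exists_fun ℂ).1 hr
  refine ⟨fun n j => if h : j < K n then c ⟨n, ⟨j, h⟩⟩ else 0, fun w => ?_⟩
  rw [← hc, Fintype.sum_sigma]
  simp only [Finset.sum_apply, Pi.smul_apply, smul_eq_mul]
  refine Finset.sum_congr rfl fun n _ => ?_
  rw [Finset.sum_range]
  simp

lemma analyticOnNhd_and_bounded_of_mem_fractionSpan {N : ℕ} {z : Fin N → ℂ} {K : Fin N → ℕ}
    (hz : ∀ n, z n ∈ Metric.ball (0 : ℂ) 1) {r : ℂ → ℂ} (hr : r ∈ fractionSpan z K) :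
    AnalyticOnNhd ℂ r (Metric.ball 0 1) ∧ ∃ C, ∀ w ∈ Metric.ball (0 : ℂ) 1, ‖r w‖ ≤ C := by
  obtain ⟨c, hc⟩ := exists_eq_sum_of_mem_fractionSpan hr
  rw [funext hc]
  constructor
  · intro w hw
    refine Finset.analyticAt_fun_sum _ fun n _ => Finset.analyticAt_fun_sum _ fun j _ => ?_
    exact analyticAt_const.mul (analyticOnNhd_fraction (hz n) j w hw)
  · refine ⟨∑ n, ∑ j ∈ Finset.range (K n), ‖c n j‖ * ((1 - ‖z n‖) ^ (j + 2))⁻¹, fun w hw => ?_⟩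
    refine (norm_sum_le _ _).trans (Finset.sum_le_sum fun n _ => ?_)
    refine (norm_sum_le _ _).trans (Finset.sum_le_sum fun j _ => ?_)
    rw [norm_mul]
    gcongr
    exact norm_fraction_le (hz n) hw j

lemma fraction_mem_orthogonalTo {a : ℂ} (ha : a ∈ Metric.ball (0 : ℂ) 1) {q : ℂ → ℂ}
    (hq : MemSpace 2 q) {K : ℕ} (hK : (K : ℕ∞) ≤ analyticOrderAt q a) {j : ℕ} (hj : j < K) :
    fraction a j ∈ orthogonalTo hq.memLp := by
  have hker := (le_analyticOrderAt_iff_orthogonal ha hq K).1 hK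
  refine ⟨memLp_of_bounded (analyticOnNhd_fraction ha j).continuousOn
    (fun w hw => norm_fraction_le ha hw j) 2, ?_⟩
  rcases eq_or_ne a 0 with rfl | h
  · simpa only [fraction_zero, kernel_zero_left] using hker j hj
  · have hsum : ∑ i ∈ Finset.range (j + 1), ((j.choose i * conj a ^ i) : ℂ) • kernel a i ∈
        orthogonalTo hq.memLp := Submodule.sum_mem _ fun i hi => Submodule.smul_mem _ _
      ⟨memLp_kernel ha i 2, hker i (by have := Finset.mem_range.1 hi; omega)⟩
    rw [← hsum.2]
    refine integral_congr_ae (ae_area_of_forall fun w hw => ?_)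
    simp only [fraction_of_ne h, one_div_pow_eq_sum_kernel ha hw, Finset.sum_apply, Pi.smul_apply,
      smul_eq_mul]

lemma fractionSpan_le_orthogonalTo {N : ℕ} {z : Fin N → ℂ} {K : Fin N → ℕ}
    (hz : ∀ n, z n ∈ Metric.ball (0 : ℂ) 1) {q : ℂ → ℂ} (hq : MemSpace 2 q)
    (hK : ∀ n, (K n : ℕ∞) ≤ analyticOrderAt q (z n)) :
    fractionSpan z K ≤ orthogonalTo hq.memLp := by
  refine Submodule.span_le.2 ?_
  rintro _ ⟨⟨n, j⟩, rfl⟩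
  exact fraction_mem_orthogonalTo (hz n) hq (hK n) j.2

lemma sum_fraction_of_ne {a : ℂ} (ha : a ≠ 0) (s : Finset ℕ) (c : ℕ → ℂ) (w : ℂ) :
    ∑ j ∈ s, c j * fraction a j w = ∑ j ∈ s, c j / (1 - conj a * w) ^ (j + 2) :=
  Finset.sum_congr rfl fun j _ => by rw [fraction_of_ne ha, mul_one_div]

/-- The two cases of the definition merge: without a zero at the origin the exponent of `w` is 0 and
the first term is a constant. -/
lemma hasCanonicalForm_iff {k N : ℕ} {z : Fin N → ℂ} {d : Fin N → ℕ}
    (hinj : Function.Injective z) {g : ℂ → ℂ} :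
    HasCanonicalForm k z d g ↔ ∃ c₀ : ℂ, ∃ r ∈ fractionSpan z (fun n => k * d n),
      ∀ w ∈ Metric.ball (0 : ℂ) 1, g w = c₀ * w ^ (k * orderAtOrigin z d) + r w := by
  have hspan : ∀ c : Fin N → ℕ → ℂ, ∑ n, ∑ j ∈ Finset.range (k * d n), c n j • fraction (z n) j ∈
      fractionSpan z (fun n => k * d n) := fun c => Submodule.sum_mem _ fun n _ =>
    Submodule.sum_mem _ fun j hj => Submodule.smul_mem _ _
      (fraction_mem_fractionSpan z (Finset.mem_range.1 hj))
  have hne : ∀ {i}, z i = 0 → ∀ n ∈ Finset.univ.erase i, z n ≠ 0 := fun hi n hn h =>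
    Finset.ne_of_mem_erase hn (hinj (h.trans hi.symm))
  have hsplit : ∀ {i}, z i = 0 → ∀ (c : Fin N → ℕ → ℂ) w,
      ∑ n, ∑ j ∈ Finset.range (k * d n), c n j * fraction (z n) j w =
      ∑ j ∈ Finset.range (k * d i), c i j * w ^ j + ∑ n ∈ Finset.univ.erase i,
        ∑ j ∈ Finset.range (k * d n), c n j / (1 - conj (z n) * w) ^ (j + 2) := by
    intro i hi c w
    rw [← Finset.add_sum_erase _ _ (Finset.mem_univ i), hi]
    simp only [fraction_zero]
    exact congrArg _ (Finset.sum_congr rfl fun n hn => sum_fraction_of_ne (hne hi n hn) _ _ _)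
  constructor
  · intro hg
    by_cases h : ∀ n, z n ≠ 0
    · obtain ⟨c₀, c, hc⟩ := hg.1 h
      refine ⟨c₀, _, hspan c, fun w hw => ?_⟩
      rw [hc w hw, orderAtOrigin_of_forall_ne d h, mul_zero, pow_zero, mul_one]
      simp only [Finset.sum_apply, Pi.smul_apply, smul_eq_mul]
      exact congrArg _ (Finset.sum_congr rfl fun n _ => (sum_fraction_of_ne (h n) _ _ _).symm)
    · push Not at h
      obtain ⟨i, hi⟩ := h
      obtain ⟨c₀, c, hc⟩ := hg.2 i hi
      refine ⟨c₀, _, hspan c, fun w hw => ?_⟩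
      rw [hc w hw, orderAtOrigin_of_eq d hinj hi, add_assoc, ← hsplit hi]
      simp only [Finset.sum_apply, Pi.smul_apply, smul_eq_mul]
  · rintro ⟨c₀, r, hr, hgr⟩
    obtain ⟨c, hc⟩ := exists_eq_sum_of_mem_fractionSpan hr
    refine ⟨fun h => ⟨c₀, c, fun w hw => ?_⟩, fun i hi => ⟨c₀, c, fun w hw => ?_⟩⟩
    · rw [hgr w hw, hc, orderAtOrigin_of_forall_ne d h, mul_zero, pow_zero, mul_one]
      exact congrArg _ (Finset.sum_congr rfl fun n _ => sum_fraction_of_ne (h n) _ _ _)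
    · rw [hgr w hw, hc, orderAtOrigin_of_eq d hinj hi, hsplit hi, add_assoc]

/-- Against the functions with the prescribed zeros, a function of canonical form represents a
multiple of a derivative at the origin. -/
lemma HasCanonicalForm.exists_integral_eq {k N : ℕ} {z : Fin N → ℂ} {d : Fin N → ℕ} {g : ℂ → ℂ}
    (hz : ∀ n, z n ∈ Metric.ball (0 : ℂ) 1) (hinj : Function.Injective z)
    (hg : HasCanonicalForm k z d g) :
    ∃ A : ℂ, ∀ q, MemSpace 2 q → (∀ n, ((k * d n : ℕ) : ℕ∞) ≤ analyticOrderAt q (z n)) →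
      ∫ w, conj (g w) * q w ∂area = A * iteratedDeriv (k * orderAtOrigin z d) q 0 := by
  have h0 : (0 : ℂ) ∈ Metric.ball (0 : ℂ) 1 := Metric.mem_ball_self one_pos
  obtain ⟨c₀, r, hr, hgr⟩ := (hasCanonicalForm_iff hinj).1 hg
  set M := k * orderAtOrigin z d
  -- The fractions are orthogonal to `q`, so only `c₀ * w ^ M` contributes, and `w ^ M` is the
  -- kernel at 0 for the `M`-th derivative.
  refine ⟨conj c₀ * ((M + 1).factorial : ℂ)⁻¹, fun q hq hv => ?_⟩
  have hrq := fractionSpan_le_orthogonalTo hz hq hv hr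
  have e : ∫ w, conj (g w) * q w ∂area =
      ∫ w, (conj c₀ * (conj (kernel 0 M w) * q w) + conj (r w) * q w) ∂area := by
    refine integral_congr_ae (ae_area_of_forall fun w hw => ?_)
    simp only [hgr w hw, kernel_zero_left, map_add, map_mul]
    ring
  rw [e, integral_add ((integrable_conj_mul (memLp_kernel h0 M 2) hq.memLp).const_mul _)
    (integrable_conj_mul hrq.1 hq.memLp), hrq.2, add_zero, integral_const_mul,
    iteratedDeriv_eq_integral h0 hq]
  have : ((M + 1).factorial : ℂ) ≠ 0 := by exact_mod_cast Nat.factorial_ne_zero _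
  field_simp


/-! ### No extra zeros -/

lemma ofReal_integral_normSq {f : ℂ → ℂ} (hf : MemLp f 2 area) :
    ENNReal.ofReal (∫ w, ‖f w‖ ^ 2 ∂area) = normSq f :=
  ofReal_integral_eq_lintegral_ofReal ((memLp_two_iff_integrable_sq_norm hf.1).1 hf)
    (Filter.Eventually.of_forall fun w => by positivity)

lemma memLp_two_of_normSq_ne_top {f : ℂ → ℂ} (hf : ContinuousOn f (Metric.ball 0 1))
    (h : normSq f ≠ ∞) : MemLp f 2 area := by
  have hm := aestronglyMeasurable_area hf
  rw [memLp_two_iff_integrable_sq_norm hm]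
  exact (lintegral_ofReal_ne_top_iff_integrable (hm.norm.pow 2)
    (Filter.Eventually.of_forall fun w => sq_nonneg ‖f w‖)).1 h

lemma integral_conj_mul_self (f : ℂ → ℂ) :
    ∫ w, conj (f w) * f w ∂area = ((∫ w, ‖f w‖ ^ 2 ∂area : ℝ) : ℂ) := by
  rw [← integral_complex_ofReal]
  congr 1
  ext w
  rw [Complex.conj_mul']
  push_cast
  rfl

/-- Cauchy-Schwarz before optimization: the integral of `‖f - t * g‖ ^ 2` is nonnegative. -/
lemma two_mul_re_integral_le {f g : ℂ → ℂ} (hf : MemLp f 2 area) (hg : MemLp g 2 area) (t : ℂ) :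
    2 * (conj t * ∫ w, conj (g w) * f w ∂area).re ≤
      ∫ w, ‖f w‖ ^ 2 ∂area + ‖t‖ ^ 2 * ∫ w, ‖g w‖ ^ 2 ∂area := by
  have h1 := (memLp_two_iff_integrable_sq_norm hf.1).1 hf
  have h2 := (memLp_two_iff_integrable_sq_norm hg.1).1 hg
  have h3 := (integrable_conj_mul hg hf).const_mul (conj t)
  rw [← integral_const_mul, ← RCLike.re_eq_complex_re, ← integral_re h3, ← integral_const_mul,
    ← integral_const_mul, ← integral_add h1 (h2.const_mul _)]
  refine integral_mono (h3.re.const_mul 2) (h1.add (h2.const_mul _)) fun w => ?_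
  have h4 : 0 ≤ ‖f w - t * g w‖ ^ 2 := by positivity
  have h5 : ‖f w - t * g w‖ ^ 2 =
      ‖f w‖ ^ 2 + ‖t‖ ^ 2 * ‖g w‖ ^ 2 - 2 * (conj t * (conj (g w) * f w)).re := by
    simp only [← Complex.normSq_eq_norm_sq, Complex.normSq_apply, Complex.sub_re, Complex.sub_im,
      Complex.mul_re, Complex.mul_im, Complex.conj_re, Complex.conj_im]
    ring
  simp only [RCLike.re_eq_complex_re]
  linarith

lemma orderAtOrigin_le_analyticOrderAt {k N : ℕ} {z : Fin N → ℂ} {d : Fin N → ℕ}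
    (hinj : Function.Injective z) {f : ℂ → ℂ}
    (hf : ∀ n, ((k * d n : ℕ) : ℕ∞) ≤ analyticOrderAt f (z n)) :
    ((k * orderAtOrigin z d : ℕ) : ℕ∞) ≤ analyticOrderAt f 0 := by
  by_cases h : ∀ n, z n ≠ 0
  · simp [orderAtOrigin_of_forall_ne d h]
  · push Not at h
    obtain ⟨i, hi⟩ := h
    rw [orderAtOrigin_of_eq d hinj hi, ← hi]
    exact hf i

/-- A nonzero function that represents a multiple of a derivative at the origin, against the
functions in `A^2` with the prescribed zeros, has no other zeros than the prescribed ones. -/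
lemma not_exists_extra_zero {k N : ℕ} {z : Fin N → ℂ} {d : Fin N → ℕ} {g : ℂ → ℂ} {A : ℂ}
    (hz : ∀ n, z n ∈ Metric.ball (0 : ℂ) 1) (hinj : Function.Injective z) (hg : MemSpace 2 g)
    (hgv : ∀ n, ((k * d n : ℕ) : ℕ∞) ≤ analyticOrderAt g (z n))
    (hA : ∀ q, MemSpace 2 q → (∀ n, ((k * d n : ℕ) : ℕ∞) ≤ analyticOrderAt q (z n)) →
      ∫ w, conj (g w) * q w ∂area = A * iteratedDeriv (k * orderAtOrigin z d) q 0)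
    (hg0 : ∫ w, ‖g w‖ ^ 2 ∂area ≠ 0) {a : ℂ} (ha : a ∈ Metric.ball (0 : ℂ) 1) {u : ℂ → ℂ}
    (hu : AnalyticOnNhd ℂ u (Metric.ball 0 1))
    (hgu : ∀ w ∈ Metric.ball (0 : ℂ) 1, g w = (w - a) * u w) :
    ∃ n, ¬ ((k * d n : ℕ) : ℕ∞) ≤ analyticOrderAt u (z n) := by
  by_contra! huv
  have h0 : (0 : ℂ) ∈ Metric.ball (0 : ℂ) 1 := Metric.mem_ball_self one_pos
  have ha1 : ‖a‖ < 1 := by simpa using ha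
  have hφ := analyticOnNhd_involution ha
  have hne : ∀ w ∈ Metric.ball (0 : ℂ) 1, 2 - conj a * involution a w ≠ 0 := by
    intro w hw h
    have h1 : ‖conj a * involution a w‖ ≤ 1 := by
      rw [norm_mul, Complex.norm_conj]
      have := involution_mem_ball ha hw
      rw [mem_ball_zero_iff] at this
      exact mul_le_one₀ ha1.le (norm_nonneg _) this.le
    rw [← sub_eq_zero.1 h, Complex.norm_ofNat] at h1
    norm_num at h1
  -- `v` is the zero-free quotient of `w - a` by the one-point divisor, so that `f = v * u` is `g`
  -- divided by that divisor and keeps the prescribed zeros.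
  set v : ℂ → ℂ := fun w => -(1 - conj a * w) / (2 - conj a * involution a w) with hvdef
  have hv : AnalyticOnNhd ℂ v (Metric.ball 0 1) := fun w hw => by
    have := hφ w hw
    exact AnalyticAt.div (by fun_prop) (by fun_prop) (hne w hw)
  have hv0 : ∀ w ∈ Metric.ball (0 : ℂ) 1, v w ≠ 0 := fun w hw =>
    div_ne_zero (neg_ne_zero.2 (one_sub_conj_mul_ne_zero ha hw)) (hne w hw)
  set f : ℂ → ℂ := fun w => v w * u w with hfdef
  have hf : AnalyticOnNhd ℂ f (Metric.ball 0 1) := fun w hw => (hv w hw).mul (hu w hw)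
  have hgf : ∀ w ∈ Metric.ball (0 : ℂ) 1,
      g w = involution a w * (2 - conj a * involution a w) * f w := by
    intro w hw
    have h1 := one_sub_conj_mul_ne_zero ha hw
    have h2 := hne w hw
    have e : involution a w * (1 - conj a * w) = a - w := div_mul_cancel₀ _ h1
    have e' : (2 - conj a * involution a w) * v w = -(1 - conj a * w) := mul_div_cancel₀ _ h2
    rw [hgu w hw]
    linear_combination -(involution a w * u w) * e' + u w * e
  have hfv : ∀ n, ((k * d n : ℕ) : ℕ∞) ≤ analyticOrderAt f (z n) := fun n => by
    rw [analyticOrderAt_eq_of_eq_mul (hz n) (hv _ (hz n)) (hv0 _ (hz n)) (hu _ (hz n))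
      fun w _ => rfl]
    exact huv n
  have hle : ENNReal.ofReal (2 - ‖a‖ ^ 2) * normSq f ≤ normSq g :=
    (normSq_le_normSq_singleDivisor_mul ha hf).trans_eq (normSq_congr fun w hw => (hgf w hw).symm)
  have hs : 0 < 2 - ‖a‖ ^ 2 := by nlinarith [norm_nonneg a]
  have hfL : MemLp f 2 area := by
    refine memLp_two_of_normSq_ne_top hf.continuousOn fun htop => ?_
    rw [htop, ENNReal.mul_top (by simpa using hs), ← ofReal_integral_normSq hg.memLp] at hle
    exact ENNReal.ofReal_ne_top (top_le_iff.1 hle)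
  rw [← ofReal_integral_normSq hg.memLp, ← ofReal_integral_normSq hfL, ← ENNReal.ofReal_mul hs.le,
    ENNReal.ofReal_le_ofReal_iff (integral_nonneg fun w => by positivity)] at hle
  have hgI := hA g hg hgv
  have hfI := hA f ⟨hf, hfL⟩ hfv
  rw [integral_conj_mul_self] at hgI
  obtain ⟨f₀, hf₀, hff₀⟩ := exists_eq_pow_mul_of_le_analyticOrderAt hf h0
    (orderAtOrigin_le_analyticOrderAt hinj hfv)
  simp only [sub_zero] at hff₀
  have hf' := iteratedDeriv_of_eq_pow_mul (hf₀ 0 h0) (eventuallyEq_of_eqOn_ball hff₀ h0)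
  have hg' := iteratedDeriv_of_eq_pow_mul (f := g) (m := k * orderAtOrigin z d)
    (u := fun w => involution a w * (2 - conj a * involution a w) * f₀ w)
    (by have := hφ 0 h0; have := hf₀ 0 h0; fun_prop)
    (eventuallyEq_of_eqOn_ball (fun w hw => by rw [hgf w hw, hff₀ w hw]; ring) h0)
  have hφ0 : involution a 0 = a := by simp [involution]
  set S := ∫ w, ‖g w‖ ^ 2 ∂area
  have hS : 0 < S := lt_of_le_of_ne (integral_nonneg fun w => by positivity) hg0.symm
  -- Both `f` and `g` vanish to order `M` at 0, so their `M`-th derivatives there differ by the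
  -- value of the one-point divisor at 0.
  have hrel : (S : ℂ) = a * (2 - conj a * a) * ∫ w, conj (g w) * f w ∂area := by
    rw [hgI, hfI, hg', hf', hφ0]
    ring
  have hs' : (2 - conj a * a : ℂ) = ((2 - ‖a‖ ^ 2 : ℝ) : ℂ) := by
    rw [Complex.conj_mul']
    push_cast
    rfl
  rw [hs'] at hrel
  have hsne : ((2 - ‖a‖ ^ 2 : ℝ) : ℂ) ≠ 0 := by exact_mod_cast hs.ne'
  have hane : a ≠ 0 := by
    rintro rfl
    rw [zero_mul, zero_mul] at hrel
    exact hS.ne' (by exact_mod_cast hrel)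
  have hI : ∫ w, conj (g w) * f w ∂area = (a * ((2 - ‖a‖ ^ 2 : ℝ) : ℂ))⁻¹ * S := by
    rw [hrel]
    field_simp
  -- This `t` is the optimal one: `t * g` is the projection of `f` onto `g`.
  have hcs := two_mul_re_integral_le hfL hg.memLp (a * ((2 - ‖a‖ ^ 2 : ℝ) : ℂ))⁻¹
  rw [hI, ← mul_assoc, Complex.conj_mul', ← Complex.ofReal_pow, ← Complex.ofReal_mul,
    Complex.ofReal_re, norm_inv, norm_mul, Complex.norm_real, Real.norm_of_nonneg hs.le] at hcs
  have hapos : 0 < ‖a‖ := norm_pos_iff.2 hane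
  generalize ‖a‖ = r at *
  generalize ∫ w, ‖f w‖ ^ 2 ∂area = T at *
  have h1 : (r * (2 - r ^ 2))⁻¹ ^ 2 * S ≤ T := by linarith
  have h2 : (2 - r ^ 2) * ((r * (2 - r ^ 2))⁻¹ ^ 2 * S) ≤ S :=
    (mul_le_mul_of_nonneg_left h1 hs.le).trans hle
  have h3 : (2 - r ^ 2) * ((r * (2 - r ^ 2))⁻¹ ^ 2 * S) = S / (r ^ 2 * (2 - r ^ 2)) := by
    field_simp
  rw [h3, div_le_iff₀ (by positivity)] at h2
  -- The two bounds gave `S ≤ r² (2 - r²) S`, while `1 - r² (2 - r²) = (1 - r²)²` is positive.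
  have h4 : r ^ 2 * (2 - r ^ 2) < 1 := by
    have : 0 < 1 - r ^ 2 := by nlinarith
    nlinarith [mul_pos this this]
  nlinarith


/-! ### Existence in `A^2` -/

/-- Orthogonal projection in `Lp` onto the finite-dimensional image of `W`, pulled back from classes
to functions. -/
lemma exists_orthogonal_decomposition (W : Submodule ℂ (ℂ → ℂ)) [FiniteDimensional ℂ W]
    (hW : ∀ f ∈ W, MemLp f 2 area) {v : ℂ → ℂ} (hv : MemLp v 2 area) :
    ∃ r ∈ W, ∀ h ∈ W, ∫ w, conj (h w) * (v w - r w) ∂area = 0 := by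
  let T : W →ₗ[ℂ] Lp ℂ 2 area :=
    { toFun := fun f => (hW f f.2).toLp f
      map_add' := fun f g => MemLp.toLp_add _ _
      map_smul' := fun c f => MemLp.toLp_const_smul c _ }
  obtain ⟨r, hr⟩ := LinearMap.mem_range.1
    ((LinearMap.range T).starProjection_apply_mem (hv.toLp v))
  refine ⟨r, r.2, fun h hh => ?_⟩
  have h1 := Submodule.sub_starProjection_mem_orthogonal (K := LinearMap.range T) (hv.toLp v)
  have h2 := (Submodule.mem_orthogonal _ _).1 h1 (T ⟨h, hh⟩) ⟨_, rfl⟩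
  rw [← hr, L2.inner_def] at h2
  rw [← h2]
  refine integral_congr_ae ?_
  have e : hv.toLp v - T r = (hv.sub (hW r r.2)).toLp (v - (r : ℂ → ℂ)) :=
    (MemLp.toLp_sub hv (hW r r.2)).symm
  rw [e]
  filter_upwards [MemLp.coeFn_toLp (hv.sub (hW r r.2)), MemLp.coeFn_toLp (hW h hh)] with w hw hw'
  rw [hw, RCLike.inner_apply, mul_comm]
  simp only [T, LinearMap.coe_mk, AddHom.coe_mk, hw', Pi.sub_apply]

lemma exists_kernel_eq_sum_fraction {a : ℂ} (ha : a ∈ Metric.ball (0 : ℂ) 1) (j : ℕ) :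
    ∃ c : ℕ → ℂ, ∀ w ∈ Metric.ball (0 : ℂ) 1,
      kernel a j w = ∑ i ∈ Finset.range (j + 1), c i * fraction a i w := by
  rcases eq_or_ne a 0 with rfl | h
  · refine ⟨fun i => if i = j then 1 else 0, fun w _ => ?_⟩
    simp [kernel_zero_left, fraction_zero]
  · have h' : conj a ^ j ≠ 0 := pow_ne_zero _ ((map_ne_zero _).2 h)
    refine ⟨fun i => (conj a ^ j)⁻¹ * ((-1) ^ (j - i) * j.choose i), fun w hw => ?_⟩
    rw [← mul_right_inj' h', conj_pow_mul_kernel_eq_sum ha hw, Finset.mul_sum]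
    refine Finset.sum_congr rfl fun i _ => ?_
    rw [fraction_of_ne h]
    field_simp

lemma prod_sub_pow_eq_pow_mul {N : ℕ} (z : Fin N → ℂ) (d : Fin N → ℕ) (k : ℕ) :
    ∃ u : ℂ → ℂ, AnalyticOnNhd ℂ u Set.univ ∧ u 0 ≠ 0 ∧
      ∀ w, ∏ n, (w - z n) ^ (k * d n) = w ^ (k * orderAtOrigin z d) * u w := by
  classical
  refine ⟨fun w => ∏ n, if z n = 0 then 1 else (w - z n) ^ (k * d n), fun w _ => ?_, ?_,
    fun w => ?_⟩
  · refine Finset.analyticAt_fun_prod _ fun n _ => ?_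
    split_ifs <;> fun_prop
  · refine Finset.prod_ne_zero_iff.2 fun n _ => ?_
    split_ifs with h
    · exact one_ne_zero
    · exact pow_ne_zero _ (by simpa using h)
  · rw [orderAtOrigin, Finset.mul_sum, ← Finset.prod_pow_eq_pow_sum, ← Finset.prod_mul_distrib]
    refine Finset.prod_congr rfl fun n _ => ?_
    split_ifs with h <;> simp [h]

lemma le_analyticOrderAt_of_eq_prod_mul {N : ℕ} {z : Fin N → ℂ} {K : Fin N → ℕ} {f u : ℂ → ℂ}
    (hz : ∀ n, z n ∈ Metric.ball (0 : ℂ) 1) (hu : AnalyticOnNhd ℂ u (Metric.ball 0 1))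
    (h : ∀ w ∈ Metric.ball (0 : ℂ) 1, f w = (∏ n, (w - z n) ^ K n) * u w) (n : Fin N) :
    (K n : ℕ∞) ≤ analyticOrderAt f (z n) := by
  classical
  have hun := hu _ (hz n)
  have e := eventuallyEq_of_eqOn_ball (f := f) (g := fun w => (w - z n) ^ K n •
    ((∏ i ∈ Finset.univ.erase n, (w - z i) ^ K i) * u w))
    (fun w hw => by rw [h w hw, ← Finset.mul_prod_erase _ _ (Finset.mem_univ n), smul_eq_mul,
      mul_assoc]) (hz n)
  have ha : AnalyticAt ℂ (fun w => (∏ i ∈ Finset.univ.erase n, (w - z i) ^ K i) * u w) (z n) := by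
    fun_prop
  rw [analyticOrderAt_congr e, natCast_le_analyticOrderAt (by fun_prop)]
  exact ⟨_, ha, Filter.Eventually.of_forall fun w => rfl⟩

lemma HasCanonicalForm.const_mul {k N : ℕ} {z : Fin N → ℂ} {d : Fin N → ℕ} {g : ℂ → ℂ}
    (hinj : Function.Injective z) (hg : HasCanonicalForm k z d g) (t : ℂ) :
    HasCanonicalForm k z d (fun w => t * g w) := by
  obtain ⟨c₀, r, hr, h⟩ := (hasCanonicalForm_iff hinj).1 hg
  refine (hasCanonicalForm_iff hinj).2 ⟨t * c₀, _, Submodule.smul_mem _ t hr, fun w hw => ?_⟩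
  simp only [h w hw, mul_add, mul_assoc, Pi.smul_apply, smul_eq_mul]

/-- Existence of the extremal function in `A^2`, up to normalization. -/
lemma exists_hasCanonicalForm_vanishing {k N : ℕ} {z : Fin N → ℂ} {d : Fin N → ℕ}
    (hz : ∀ n, z n ∈ Metric.ball (0 : ℂ) 1) (hinj : Function.Injective z) :
    ∃ g : ℂ → ℂ, AnalyticOnNhd ℂ g (Metric.ball 0 1) ∧
      (∃ C, ∀ w ∈ Metric.ball (0 : ℂ) 1, ‖g w‖ ≤ C) ∧
      (∀ n, ((k * d n : ℕ) : ℕ∞) ≤ analyticOrderAt g (z n)) ∧ HasCanonicalForm k z d g ∧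
      0 < ∫ w, ‖g w‖ ^ 2 ∂area := by
  have h0 : (0 : ℂ) ∈ Metric.ball (0 : ℂ) 1 := Metric.mem_ball_self one_pos
  set M := k * orderAtOrigin z d
  set W := fractionSpan z (fun n => k * d n)
  have hW := fun f (hf : f ∈ W) => analyticOnNhd_and_bounded_of_mem_fractionSpan hz hf
  have hWL : ∀ f ∈ W, MemLp f 2 area := fun f hf =>
    memLp_of_bounded (hW f hf).1.continuousOn (hW f hf).2.choose_spec 2
  have hv := memLp_kernel h0 M 2
  have hker : ∀ n, ∀ j < k * d n, ∃ h ∈ W, ∀ w ∈ Metric.ball (0 : ℂ) 1, kernel (z n) j w = h w := by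
    intro n j hj
    obtain ⟨c, hc⟩ := exists_kernel_eq_sum_fraction (hz n) j
    refine ⟨∑ i ∈ Finset.range (j + 1), c i • fraction (z n) i, Submodule.sum_mem _ fun i hi =>
      Submodule.smul_mem _ _ (fraction_mem_fractionSpan z ?_), fun w hw => ?_⟩
    · have := Finset.mem_range.1 hi
      omega
    · rw [hc w hw]
      simp
  obtain ⟨r, hr, hort⟩ := exists_orthogonal_decomposition W hWL hv
  set g : ℂ → ℂ := fun w => w ^ M - r w with hg
  have hgk : ∀ w, kernel 0 M w - r w = g w := fun w => by rw [kernel_zero_left]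
  simp only [hgk] at hort
  obtain ⟨hra, C, hC⟩ := hW r hr
  have hga : AnalyticOnNhd ℂ g (Metric.ball 0 1) := fun w hw => by
    have := hra w hw
    fun_prop
  have hgC : ∀ w ∈ Metric.ball (0 : ℂ) 1, ‖g w‖ ≤ 1 + C := fun w hw => by
    refine (norm_sub_le _ _).trans (add_le_add ?_ (hC w hw))
    rw [norm_pow]
    exact pow_le_one₀ (norm_nonneg w) (by simpa using (mem_ball_zero_iff.1 hw).le)
  have hgL : MemLp g 2 area := memLp_of_bounded hga.continuousOn hgC 2
  have hgv : ∀ n, ((k * d n : ℕ) : ℕ∞) ≤ analyticOrderAt g (z n) := fun n => by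
    rw [le_analyticOrderAt_iff_orthogonal (hz n) ⟨hga, hgL⟩]
    intro j hj
    obtain ⟨h, hh, he⟩ := hker n j hj
    rw [← hort h hh]
    exact integral_congr_ae (ae_area_of_forall fun w hw => by simp only [he w hw])
  have hform : HasCanonicalForm k z d g := (hasCanonicalForm_iff hinj).2
    ⟨1, _, Submodule.neg_mem _ hr, fun w _ => by
      rw [one_mul, Pi.neg_apply, ← sub_eq_add_neg]⟩
  have hpos : 0 < ∫ w, ‖g w‖ ^ 2 ∂area := by
    refine lt_of_le_of_ne (integral_nonneg fun w => by positivity) fun hzero => ?_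
    have hg0 : g =ᵐ[area] 0 := by
      have h := (integral_eq_zero_iff_of_nonneg (fun w => sq_nonneg ‖g w‖)
        ((memLp_two_iff_integrable_sq_norm hgL.1).1 hgL)).1 hzero.symm
      filter_upwards [h] with w hw
      simpa using hw
    -- If `g` were zero, `w ^ M` would equal `r` almost everywhere and so be orthogonal to this
    -- polynomial. But the polynomial has order exactly `M` at the origin, so its `M`-th derivative
    -- there is not 0.
    set q : ℂ → ℂ := fun w => ∏ n, (w - z n) ^ (k * d n) with hq
    have hqa : AnalyticOnNhd ℂ q (Metric.ball 0 1) := fun w _ => by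
      simp only [hq]
      fun_prop
    have hqL : MemLp q 2 area := by
      have hc : Continuous q := by
        simp only [hq]
        fun_prop
      obtain ⟨C, hC⟩ := (isCompact_closedBall (0 : ℂ) 1).exists_bound_of_continuousOn
        hc.continuousOn
      exact memLp_of_bounded hqa.continuousOn (fun w hw => hC w (Metric.ball_subset_closedBall hw)) 2
    have hqv : ∀ n, ((k * d n : ℕ) : ℕ∞) ≤ analyticOrderAt q (z n) :=
      le_analyticOrderAt_of_eq_prod_mul (u := fun _ => 1) hz (fun _ _ => analyticAt_const)
        (fun w _ => by simp [hq])
    obtain ⟨u, hu, hu0, hqu⟩ := prod_sub_pow_eq_pow_mul z d k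
    have hqd := iteratedDeriv_of_eq_pow_mul (f := q) (hu 0 trivial)
      (Filter.Eventually.of_forall hqu)
    have h1 := iteratedDeriv_eq_integral h0 ⟨hqa, hqL⟩ M
    have h2 : ∫ w, conj (kernel 0 M w) * q w ∂area = ∫ w, conj (r w) * q w ∂area := by
      refine integral_congr_ae ?_
      filter_upwards [hg0] with w hw
      rw [sub_eq_zero.1 ((hgk w).trans hw)]
    have h3 := (fractionSpan_le_orthogonalTo hz ⟨hqa, hqL⟩ hqv hr).2
    rw [h2, h3, mul_zero, hqd] at h1
    exact mul_ne_zero (by exact_mod_cast Nat.factorial_ne_zero _) hu0 h1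
  exact ⟨g, hga, ⟨_, hgC⟩, hgv, hform, hpos⟩


/-! ### The sufficient condition and uniqueness -/

/-- Young's inequality for integer exponents. The inductive step adds `a` times the previous case to
`(b - a) * (b ^ (l + 1) - a ^ (l + 1)) ≥ 0`. -/
lemma add_one_mul_pow_mul_le {a b : ℝ} (ha : 0 ≤ a) (hb : 0 ≤ b) (l : ℕ) :
    (l + 1) * (a ^ l * b) ≤ l * a ^ (l + 1) + b ^ (l + 1) := by
  induction l with
  | zero => simp
  | succ l ih =>
    have h1 := mul_le_mul_of_nonneg_left ih ha
    have h2 : 0 ≤ (b - a) * (b ^ (l + 1) - a ^ (l + 1)) := by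
      rcases le_total a b with h | h
      · exact mul_nonneg (sub_nonneg.2 h) (sub_nonneg.2 (pow_le_pow_left₀ ha h _))
      · exact mul_nonneg_of_nonpos_of_nonpos (sub_nonpos.2 h)
          (sub_nonpos.2 (pow_le_pow_left₀ hb h _))
    push_cast
    ring_nf at h1 h2 ⊢
    nlinarith

lemma norm_eq_one_iff {f : ℂ → ℂ} {p : ℕ} (hp : p ≠ 0) (hf : MemLp f p area) :
    norm p f = 1 ↔ ∫ w, ‖f w‖ ^ p ∂area = 1 := by
  have hp' : (p : ℝ) ≠ 0 := by exact_mod_cast hp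
  rw [norm, hf.eLpNorm_eq_integral_rpow_norm (by exact_mod_cast hp) (ENNReal.natCast_ne_top p),
    ENNReal.toReal_natCast, ENNReal.ofReal_eq_one]
  simp only [Real.rpow_natCast]
  have h : 0 ≤ ∫ w, ‖f w‖ ^ p ∂area := integral_nonneg fun w => by positivity
  constructor
  · intro h1
    have h2 := Real.rpow_inv_rpow h hp'
    rw [h1, Real.one_rpow] at h2
    exact h2.symm
  · intro h1
    rw [h1, Real.one_rpow]

lemma sq_norm_pow_mul_le (x y : ℂ) (l : ℕ) :
    (l + 1) * ‖x ^ l * y‖ ^ 2 ≤ l * ‖x‖ ^ (2 * (l + 1)) + ‖y‖ ^ (2 * (l + 1)) := by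
  have h := add_one_mul_pow_mul_le (sq_nonneg ‖x‖) (sq_nonneg ‖y‖) l
  rw [norm_mul, norm_pow, mul_pow, ← pow_mul, mul_comm l 2, pow_mul, pow_mul ‖x‖, pow_mul ‖y‖]
  exact h

lemma memLp_pow_mul {G F : ℂ → ℂ} {l : ℕ} (hG : MemLp G (2 * (l + 1) : ℕ) area)
    (hF : MemLp F (2 * (l + 1) : ℕ) area) : MemLp (fun w => G w ^ l * F w) 2 area := by
  have hm : AEStronglyMeasurable (fun w => G w ^ l * F w) area := (hG.1.pow l).mul hF.1
  rw [memLp_two_iff_integrable_sq_norm hm]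
  have h1 := (hG.integrable_norm_pow (by omega)).const_mul (l : ℝ)
  refine (h1.add (hF.integrable_norm_pow (by omega))).mono' (hm.norm.pow 2)
    (Filter.Eventually.of_forall fun w => ?_)
  have h := sq_norm_pow_mul_le (G w) (F w) l
  rw [Real.norm_of_nonneg (by positivity)]
  refine le_trans ?_ h
  exact le_mul_of_one_le_left (by positivity) (by linarith [Nat.cast_nonneg (α := ℝ) l])

lemma two_mul_re_conj_pow_mul (x y : ℂ) (l : ℕ) :
    2 * (conj (x ^ (l + 1)) * (x ^ l * y)).re =
      ‖x‖ ^ (2 * (l + 1)) + ‖x ^ l * y‖ ^ 2 - ‖x ^ l * (x - y)‖ ^ 2 := by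
  have e : conj (x ^ (l + 1)) * (x ^ l * y) = ((‖x‖ ^ (2 * l) : ℝ) : ℂ) * (conj x * y) := by
    have h := Complex.conj_mul' (x ^ l)
    rw [norm_pow, Complex.ofReal_pow] at h
    rw [pow_succ, map_mul, mul_comm 2 l, pow_mul]
    push_cast
    rw [← h]
    ring
  rw [e, Complex.re_ofReal_mul, norm_mul, norm_mul, norm_pow, mul_pow, mul_pow, ← pow_mul,
    mul_comm l 2, mul_add, pow_add]
  have h : 2 * (conj x * y).re = ‖x‖ ^ 2 + ‖y‖ ^ 2 - ‖x - y‖ ^ 2 := by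
    simp only [← Complex.normSq_eq_norm_sq, Complex.normSq_apply, Complex.sub_re, Complex.sub_im,
      Complex.mul_re, Complex.conj_re, Complex.conj_im]
    ring
  linear_combination ‖x‖ ^ (2 * l) * h

/-- A Hölder inequality that keeps its remainder: pointwise polarization produces the square, and
Young's inequality bounds `‖G ^ l * F‖ ^ 2`. Without the square it gives extremality; the square
gives uniqueness. -/
lemma re_integral_add_le {G F : ℂ → ℂ} {l : ℕ} (hG : MemLp G (2 * (l + 1) : ℕ) area)
    (hF : MemLp F (2 * (l + 1) : ℕ) area) (hG1 : ∫ w, ‖G w‖ ^ (2 * (l + 1)) ∂area = 1)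
    (hF1 : ∫ w, ‖F w‖ ^ (2 * (l + 1)) ∂area = 1) :
    (∫ w, conj (G w ^ (l + 1)) * (G w ^ l * F w) ∂area).re +
      (1 / 2) * ∫ w, ‖G w ^ l * (G w - F w)‖ ^ 2 ∂area ≤ 1 := by
  have hGi := hG.integrable_norm_pow (by omega)
  have hFi := hF.integrable_norm_pow (by omega)
  have h2 := memLp_pow_mul hG (hG.sub hF)
  have h2i := (memLp_two_iff_integrable_sq_norm h2.1).1 h2
  have h3 : MemLp (fun w => G w ^ (l + 1)) 2 area := by
    simpa only [pow_succ] using memLp_pow_mul hG hG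
  have h4 := integrable_conj_mul h3 (memLp_pow_mul hG hF)
  have h4r : Integrable (fun w => (conj (G w ^ (l + 1)) * (G w ^ l * F w)).re) area := h4.re
  simp only [Pi.sub_apply] at h2i
  have hl : (0 : ℝ) < l + 1 := by positivity
  have hle : ∫ w, ((conj (G w ^ (l + 1)) * (G w ^ l * F w)).re +
      (1 / 2) * ‖G w ^ l * (G w - F w)‖ ^ 2) ∂area ≤
      ∫ w, (2 * (l + 1 : ℝ))⁻¹ * ((2 * l + 1) * ‖G w‖ ^ (2 * (l + 1)) + ‖F w‖ ^ (2 * (l + 1))) ∂area := by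
    refine integral_mono (h4r.add (h2i.const_mul _))
      (((hGi.const_mul _).add hFi).const_mul _) fun w => ?_
    have h5 := two_mul_re_conj_pow_mul (G w) (F w) l
    have h6 := sq_norm_pow_mul_le (G w) (F w) l
    simp only
    rw [← div_eq_inv_mul, le_div_iff₀ (by positivity)]
    nlinarith
  rw [integral_add h4r (h2i.const_mul _), integral_const_mul, integral_const_mul,
    integral_add (hGi.const_mul _) hFi, integral_const_mul, hG1, hF1] at hle
  have h7 : ∫ w, (conj (G w ^ (l + 1)) * (G w ^ l * F w)).re ∂area =
      (∫ w, conj (G w ^ (l + 1)) * (G w ^ l * F w) ∂area).re := integral_re h4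
  rw [h7] at hle
  refine hle.trans_eq ?_
  field_simp
  ring

lemma memSpace_pow_mul {G F : ℂ → ℂ} {l : ℕ} (hG : MemSpace (2 * (l + 1) : ℕ) G)
    (hF : MemSpace (2 * (l + 1) : ℕ) F) : MemSpace 2 (fun w => G w ^ l * F w) :=
  ⟨fun w hw => ((hG.analytic w hw).pow l).mul (hF.analytic w hw),
    memLp_pow_mul hG.memLp hF.memLp⟩

lemma le_analyticOrderAt_of_pow {f : ℂ → ℂ} {a : ℂ} (hf : AnalyticAt ℂ f a) {l K : ℕ}
    (h : (((l + 1) * K : ℕ) : ℕ∞) ≤ analyticOrderAt (fun w => f w ^ (l + 1)) a) :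
    (K : ℕ∞) ≤ analyticOrderAt f a := by
  have e : analyticOrderAt (fun w => f w ^ (l + 1)) a = (l + 1) • analyticOrderAt f a :=
    analyticOrderAt_pow hf (l + 1)
  rw [e] at h
  cases ho : analyticOrderAt f a with
  | top => exact le_top
  | coe o =>
    rw [ho, nsmul_eq_mul] at h
    have h' : (l + 1) * K ≤ (l + 1) * o := by exact_mod_cast h
    exact_mod_cast Nat.le_of_mul_le_mul_left h' (Nat.succ_pos l)

/-- The extremal identity for a function whose power has the canonical form. -/
lemma integral_conj_pow_mul_eq {l N : ℕ} {z : Fin N → ℂ} {d : Fin N → ℕ} {G : ℂ → ℂ}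
    (hz : ∀ n, z n ∈ Metric.ball (0 : ℂ) 1) (hinj : Function.Injective z)
    (hG : MemSpace (2 * (l + 1) : ℕ) G) (hG1 : ∫ w, ‖G w‖ ^ (2 * (l + 1)) ∂area = 1)
    (hGv : ∀ n, (((l + 1) * d n : ℕ) : ℕ∞) ≤ analyticOrderAt (fun w => G w ^ (l + 1)) (z n))
    (hform : HasCanonicalForm (l + 1) z d (fun w => G w ^ (l + 1))) {F : ℂ → ℂ}
    (hF : MemZeroSpace (2 * (l + 1) : ℕ) z d F) :
    ∫ w, conj (G w ^ (l + 1)) * (G w ^ l * F w) ∂area =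
      iteratedDeriv (orderAtOrigin z d) F 0 / iteratedDeriv (orderAtOrigin z d) G 0 := by
  have h0 : (0 : ℂ) ∈ Metric.ball (0 : ℂ) 1 := Metric.mem_ball_self one_pos
  have hGd : ∀ n, (d n : ℕ∞) ≤ analyticOrderAt G (z n) := fun n =>
    le_analyticOrderAt_of_pow (hG.analytic _ (hz n)) (hGv n)
  obtain ⟨A, hA⟩ := hform.exists_integral_eq hz hinj
  set m := orderAtOrigin z d
  have hm : ∀ {f : ℂ → ℂ}, (∀ n, (d n : ℕ∞) ≤ analyticOrderAt f (z n)) →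
      (m : ℕ∞) ≤ analyticOrderAt f 0 := fun hf => by
    simpa using orderAtOrigin_le_analyticOrderAt (k := 1) hinj (by simpa using hf)
  obtain ⟨G₁, hG₁, hGG₁⟩ := exists_eq_pow_mul_of_le_analyticOrderAt hG.analytic h0 (hm hGd)
  simp only [sub_zero] at hGG₁
  have hGm := iteratedDeriv_of_eq_pow_mul (hG₁ 0 h0) (eventuallyEq_of_eqOn_ball hGG₁ h0)
  -- The leading coefficient of `G ^ l * f` at 0 is that of `f` times a factor depending only on
  -- `G`, so the integral is a fixed multiple of the `m`-th derivative of `f`. The case `f = G`,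
  -- where the integral is 1, determines the multiple.
  have key : ∀ {f}, MemZeroSpace (2 * (l + 1) : ℕ) z d f →
      ∫ w, conj (G w ^ (l + 1)) * (G w ^ l * f w) ∂area =
      (A * ((l + 1) * m).factorial * G₁ 0 ^ l / m.factorial) * iteratedDeriv m f 0 := by
    intro f hf
    obtain ⟨f₁, hf₁, hff₁⟩ := exists_eq_pow_mul_of_le_analyticOrderAt hf.memSpace.analytic h0
      (hm hf.vanish)
    simp only [sub_zero] at hff₁
    have hfm := iteratedDeriv_of_eq_pow_mul (hf₁ 0 h0) (eventuallyEq_of_eqOn_ball hff₁ h0)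
    have hq := iteratedDeriv_of_eq_pow_mul (f := fun w => G w ^ l * f w) (m := (l + 1) * m)
      (u := fun w => G₁ w ^ l * f₁ w) (((hG₁ 0 h0).pow l).mul (hf₁ 0 h0))
      (eventuallyEq_of_eqOn_ball (fun w hw => by rw [hGG₁ w hw, hff₁ w hw]; ring) h0)
    rw [hA _ (memSpace_pow_mul hG hf.memSpace), hq, hfm]
    · have : (m.factorial : ℂ) ≠ 0 := by exact_mod_cast Nat.factorial_ne_zero _
      field_simp
    · intro n
      have e : analyticOrderAt (fun w => G w ^ l * f w) (z n) =
          l • analyticOrderAt G (z n) + analyticOrderAt f (z n) := by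
        rw [← analyticOrderAt_pow (hG.analytic _ (hz n)),
          ← analyticOrderAt_mul ((hG.analytic _ (hz n)).pow l) (hf.memSpace.analytic _ (hz n))]
        rfl
      rw [e, nsmul_eq_mul, add_mul, one_mul]
      push_cast
      exact add_le_add (mul_le_mul_right (hGd n) _) (hf.vanish n)
  have hself := key ⟨hG, hGd⟩
  have e : ∫ w, conj (G w ^ (l + 1)) * (G w ^ l * G w) ∂area = 1 := by
    simp_rw [← pow_succ]
    rw [integral_conj_mul_self]
    simp_rw [norm_pow, ← pow_mul, mul_comm (l + 1) 2]
    rw [hG1, Complex.ofReal_one]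
  rw [e] at hself
  have hne : iteratedDeriv m G 0 ≠ 0 := fun h => by simp [h] at hself
  rw [key hF, eq_div_iff hne, mul_right_comm, ← hself, one_mul]


/-- The sufficient condition for a canonical divisor. -/
theorem isCanonicalDivisor_of_hasCanonicalForm {l N : ℕ} {z : Fin N → ℂ} {d : Fin N → ℕ}
    {G : ℂ → ℂ} (hz : ∀ n, z n ∈ Metric.ball (0 : ℂ) 1) (hinj : Function.Injective z)
    (hG : MemSpace (2 * (l + 1) : ℕ) G) (hG1 : norm (2 * (l + 1) : ℕ) G = 1)
    (hpos : 0 < iteratedDeriv (orderAtOrigin z d) G 0)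
    (hGv : ∀ n, (((l + 1) * d n : ℕ) : ℕ∞) ≤ analyticOrderAt (fun w => G w ^ (l + 1)) (z n))
    (hform : HasCanonicalForm (l + 1) z d (fun w => G w ^ (l + 1))) :
    IsCanonicalDivisor (2 * (l + 1) : ℕ) z d G := by
  refine ⟨⟨hG, fun n => le_analyticOrderAt_of_pow (hG.analytic _ (hz n)) (hGv n)⟩, hG1, hpos,
    fun F hF hF1 hFpos => ?_⟩
  have hG1' := (norm_eq_one_iff (by omega) hG.memLp).1 hG1
  have h1 := re_integral_add_le hG.memLp hF.memSpace.memLp hG1'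
    ((norm_eq_one_iff (by omega) hF.memSpace.memLp).1 hF1)
  rw [integral_conj_pow_mul_eq hz hinj hG hG1' hGv hform hF] at h1
  generalize iteratedDeriv (orderAtOrigin z d) F 0 = x at *
  generalize iteratedDeriv (orderAtOrigin z d) G 0 = y at *
  rw [Complex.pos_iff] at hpos hFpos
  have hx : x = (x.re : ℂ) := Complex.ext rfl (by simp [← hFpos.2])
  have hy : y = (y.re : ℂ) := Complex.ext rfl (by simp [← hpos.2])
  have h2 : 0 ≤ ∫ w, ‖G w ^ l * (G w - F w)‖ ^ 2 ∂area := integral_nonneg fun w => by positivity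
  have h3 : x.re / y.re ≤ 1 := by
    rw [hx, hy, ← Complex.ofReal_div, Complex.ofReal_re] at h1
    linarith
  rw [hx, hy]
  exact_mod_cast (div_le_one hpos.1).1 h3

/-- A canonical divisor whose power has the canonical form is the only canonical divisor. -/
theorem eqOn_of_isCanonicalDivisor {l N : ℕ} {z : Fin N → ℂ} {d : Fin N → ℕ} {G H : ℂ → ℂ}
    (hz : ∀ n, z n ∈ Metric.ball (0 : ℂ) 1) (hinj : Function.Injective z)
    (hG : IsCanonicalDivisor (2 * (l + 1) : ℕ) z d G)
    (hGv : ∀ n, (((l + 1) * d n : ℕ) : ℕ∞) ≤ analyticOrderAt (fun w => G w ^ (l + 1)) (z n))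
    (hform : HasCanonicalForm (l + 1) z d (fun w => G w ^ (l + 1)))
    (hH : IsCanonicalDivisor (2 * (l + 1) : ℕ) z d H) : Set.EqOn H G (Metric.ball 0 1) := by
  have heq := le_antisymm (hG.le_of_competitor H hH.mem hH.norm_eq_one hH.pos)
    (hH.le_of_competitor G hG.mem hG.norm_eq_one hG.pos)
  have hG' := hG.mem.memSpace
  have hH' := hH.mem.memSpace
  have hG1 := (norm_eq_one_iff (by omega) hG'.memLp).1 hG.norm_eq_one
  have h1 := re_integral_add_le hG'.memLp hH'.memLp hG1
    ((norm_eq_one_iff (by omega) hH'.memLp).1 hH.norm_eq_one)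
  rw [integral_conj_pow_mul_eq hz hinj hG' hG1 hGv hform hH.mem, heq, div_self hG.pos.ne',
    Complex.one_re] at h1
  have hL : MemLp (fun w => G w ^ l * (G w - H w)) 2 area :=
    memLp_pow_mul hG'.memLp (hG'.memLp.sub hH'.memLp)
  -- The derivative ratio is 1 and already exhausts the bound, so nothing is left for the square.
  -- The identity theorem then leaves `G ^ l = 0`, excluded by the norm, or `G = H`.
  have h2 : ∫ w, ‖G w ^ l * (G w - H w)‖ ^ 2 ∂area = 0 :=
    le_antisymm (by linarith) (integral_nonneg fun w => by positivity)
  have h3 := (integral_eq_zero_iff_of_nonneg (fun w => sq_nonneg ‖G w ^ l * (G w - H w)‖)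
    ((memLp_two_iff_integrable_sq_norm hL.1).1 hL)).1 h2
  have hGa : AnalyticOnNhd ℂ (fun w => G w ^ l) (Metric.ball 0 1) := fun w hw =>
    (hG'.analytic w hw).pow l
  have hGHa : AnalyticOnNhd ℂ (fun w => G w - H w) (Metric.ball 0 1) := fun w hw =>
    (hG'.analytic w hw).sub (hH'.analytic w hw)
  have h4 : Set.EqOn (fun w => G w ^ l * (G w - H w)) (fun _ => 0) (Metric.ball 0 1) := by
    refine eqOn_of_ae_eq (hGa.mul hGHa).continuousOn continuousOn_const ?_
    filter_upwards [h3] with w hw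
    simpa using hw
  rcases hGa.eq_zero_or_eq_zero_of_mul_eq_zero hGHa h4
    (convex_ball (0 : ℂ) 1).isPreconnected with h | h
  · exfalso
    have h5 : ∫ w, ‖G w‖ ^ (2 * (l + 1)) ∂area = 0 := by
      rw [← integral_zero ℂ ℝ (μ := area)]
      refine integral_congr_ae (ae_area_of_forall fun w hw => ?_)
      have hw0 : G w = 0 := eq_zero_of_pow_eq_zero (h w hw)
      simp [hw0]
    rw [h5] at hG1
    exact zero_ne_one hG1
  · exact fun w hw => (sub_eq_zero.1 (h w hw)).symm

/-! ### Existence -/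

lemma exists_analytic_pow_eq {u : ℂ → ℂ} (hu : AnalyticOnNhd ℂ u (Metric.ball 0 1))
    (hu0 : ∀ w ∈ Metric.ball (0 : ℂ) 1, u w ≠ 0) {k : ℕ} (hk : k ≠ 0) :
    ∃ v : ℂ → ℂ, AnalyticOnNhd ℂ v (Metric.ball 0 1) ∧
      ∀ w ∈ Metric.ball (0 : ℂ) 1, v w ^ k = u w := by
  have h0 : (0 : ℂ) ∈ Metric.ball (0 : ℂ) 1 := Metric.mem_ball_self one_pos
  have hd : DifferentiableOn ℂ (fun w => deriv u w / u w) (Metric.ball 0 1) :=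
    hu.deriv.differentiableOn.div hu.differentiableOn hu0
  -- A primitive of the logarithmic derivative, normalized at 0, is a logarithm of `u`; the root is
  -- `exp (L / k)`.
  obtain ⟨L, hL0, hL⟩ := hd.isExactOn_ball.with_val_at 0 (Complex.log (u 0))
  have hLd : DifferentiableOn ℂ L (Metric.ball 0 1) := fun w hw =>
    (hL w hw).differentiableAt.differentiableWithinAt
  have hconst : ∀ w ∈ Metric.ball (0 : ℂ) 1, HasDerivAt (fun w => u w * Complex.exp (-L w)) 0 w := by
    intro w hw
    have h := (hu w hw).differentiableAt.hasDerivAt.mul (hL w hw).neg.cexp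
    convert! h using 1
    have := hu0 w hw
    field_simp
    ring
  have heq : ∀ w ∈ Metric.ball (0 : ℂ) 1, u w * Complex.exp (-L w) = 1 := by
    intro w hw
    rw [Metric.isOpen_ball.is_const_of_deriv_eq_zero (convex_ball (0 : ℂ) 1).isPreconnected
      (fun w hw => (hconst w hw).differentiableAt.differentiableWithinAt)
      (fun w hw => (hconst w hw).deriv) hw h0, hL0, Complex.exp_neg, Complex.exp_log (hu0 0 h0),
      mul_inv_cancel₀ (hu0 0 h0)]
  refine ⟨fun w => Complex.exp (L w / k), ?_, fun w hw => ?_⟩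
  · exact (hLd.div_const _).cexp.analyticOnNhd Metric.isOpen_ball
  · have hk' : (k : ℂ) ≠ 0 := by exact_mod_cast hk
    rw [← Complex.exp_nat_mul, mul_div_cancel₀ _ hk']
    have h := heq w hw
    rw [Complex.exp_neg, mul_inv_eq_one₀ (Complex.exp_ne_zero _)] at h
    exact h.symm

lemma analyticOrderAt_eq_of_eq_prod_mul {N : ℕ} {z : Fin N → ℂ} {K : Fin N → ℕ} {f u : ℂ → ℂ}
    (hz : ∀ n, z n ∈ Metric.ball (0 : ℂ) 1) (hinj : Function.Injective z)
    (hu : AnalyticOnNhd ℂ u (Metric.ball 0 1)) (hu0 : ∀ w ∈ Metric.ball (0 : ℂ) 1, u w ≠ 0)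
    (h : ∀ w ∈ Metric.ball (0 : ℂ) 1, f w = (∏ n, (w - z n) ^ K n) * u w) (n : Fin N) :
    analyticOrderAt f (z n) = K n := by
  classical
  have hun := hu _ (hz n)
  have e := eventuallyEq_of_eqOn_ball (f := f) (g := fun w => (w - z n) ^ K n •
    ((∏ i ∈ Finset.univ.erase n, (w - z i) ^ K i) * u w))
    (fun w hw => by rw [h w hw, ← Finset.mul_prod_erase _ _ (Finset.mem_univ n), smul_eq_mul,
      mul_assoc]) (hz n)
  have ha : AnalyticAt ℂ (fun w => (∏ i ∈ Finset.univ.erase n, (w - z i) ^ K i) * u w) (z n) := by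
    fun_prop
  rw [analyticOrderAt_congr e, AnalyticAt.analyticOrderAt_eq_natCast (by fun_prop)]
  refine ⟨_, ha, mul_ne_zero (Finset.prod_ne_zero_iff.2 fun i hi => pow_ne_zero _ ?_)
    (hu0 _ (hz n)), Filter.Eventually.of_forall fun w => rfl⟩
  exact sub_ne_zero.2 fun h => Finset.ne_of_mem_erase hi (hinj h.symm)

/-- Existence of a function with all the properties of the canonical divisor. -/
theorem exists_characterized {l N : ℕ} {z : Fin N → ℂ} {d : Fin N → ℕ}
    (hz : ∀ n, z n ∈ Metric.ball (0 : ℂ) 1) (hinj : Function.Injective z) :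
    ∃ G : ℂ → ℂ, MemSpace (2 * (l + 1) : ℕ) G ∧ norm (2 * (l + 1) : ℕ) G = 1 ∧
      0 < iteratedDeriv (orderAtOrigin z d) G 0 ∧
      (∀ n, analyticOrderAt (fun w => G w ^ (l + 1)) (z n) = (((l + 1) * d n : ℕ) : ℕ∞)) ∧
      HasCanonicalForm (l + 1) z d (fun w => G w ^ (l + 1)) := by
  have h0 : (0 : ℂ) ∈ Metric.ball (0 : ℂ) 1 := Metric.mem_ball_self one_pos
  obtain ⟨g, hg, ⟨C, hC⟩, hgv, hform, hgpos⟩ :=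
    exists_hasCanonicalForm_vanishing (k := l + 1) (d := d) hz hinj
  have hgL : MemSpace 2 g := ⟨hg, memLp_of_bounded hg.continuousOn hC 2⟩
  obtain ⟨A, hA⟩ := hform.exists_integral_eq hz hinj
  obtain ⟨u, hu, hgu⟩ := exists_eq_prod_mul hg hz hinj hgv Finset.univ
  have hu0 : ∀ a ∈ Metric.ball (0 : ℂ) 1, u a ≠ 0 := by
    intro a ha hua
    obtain ⟨u₁, hu₁, huu₁⟩ := exists_eq_pow_mul_of_le_analyticOrderAt (K := 1) hu ha
      (Order.one_le_iff_ne_zero.2 ((hu a ha).analyticOrderAt_ne_zero.2 hua))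
    -- A zero of `u` would be an extra zero of `g`: the cofactor of `w - a` still contains the full
    -- product. This also covers `a` equal to some `z n`.
    obtain ⟨n, hn⟩ := not_exists_extra_zero hz hinj hgL hgv hA hgpos.ne' ha
      (u := fun w => (∏ n, (w - z n) ^ ((l + 1) * d n)) * u₁ w)
      (fun w hw => by have := hu₁ w hw; fun_prop)
      (fun w hw => by rw [hgu w hw, huu₁ w hw]; ring)
    exact hn (le_analyticOrderAt_of_eq_prod_mul hz hu₁ (fun w _ => rfl) n)
  obtain ⟨v, hv, hvu⟩ := exists_analytic_pow_eq hu hu0 (Nat.succ_ne_zero l)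
  have hv0 : v 0 ≠ 0 := fun h => hu0 0 h0 (by rw [← hvu 0 h0, h, zero_pow (Nat.succ_ne_zero l)])
  obtain ⟨u₀, hu₀, hu₀0, hprod⟩ := prod_sub_pow_eq_pow_mul z d 1
  simp only [one_mul] at hprod
  set S := ∫ w, ‖g w‖ ^ 2 ∂area with hS
  set c := u₀ 0 * v 0 with hc
  have hc0 : c ≠ 0 := mul_ne_zero hu₀0 hv0
  obtain ⟨t, ht, htS⟩ : ∃ t : ℝ, 0 < t ∧ t ^ (2 * (l + 1)) * S = 1 := by
    refine ⟨(S ^ ((2 * (l + 1) : ℕ) : ℝ)⁻¹)⁻¹, by positivity, ?_⟩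
    rw [inv_pow, Real.rpow_inv_natCast_pow hgpos.le (by omega), inv_mul_cancel₀ hgpos.ne']
  -- The modulus `t` normalizes the norm, and the argument rotates `c`, the value at 0 of the
  -- quotient of the unnormalized root by `w ^ m` with `m` the order at the origin, to the positive
  -- axis.
  set ζ : ℂ := t * ‖c‖ / c with hζ
  have hζn : ‖ζ‖ = t := by
    rw [hζ, norm_div, norm_mul, Complex.norm_real, Complex.norm_real, norm_norm,
      Real.norm_of_nonneg ht.le, mul_div_cancel_right₀ _ (norm_ne_zero_iff.2 hc0)]
  have hζ0 : ζ ≠ 0 := norm_ne_zero_iff.1 (hζn ▸ ht.ne')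
  set G : ℂ → ℂ := fun w => ζ * ((∏ n, (w - z n) ^ d n) * v w) with hG
  have hGa : AnalyticOnNhd ℂ G (Metric.ball 0 1) := fun w hw => by
    have := hv w hw
    fun_prop
  have hGg : ∀ w ∈ Metric.ball (0 : ℂ) 1, G w ^ (l + 1) = ζ ^ (l + 1) * g w := by
    intro w hw
    rw [hG, hgu w hw, ← hvu w hw, mul_pow, mul_pow, ← Finset.prod_pow]
    simp only [← pow_mul, mul_comm (l + 1)]
  have hGn : ∀ w ∈ Metric.ball (0 : ℂ) 1,
      ‖G w‖ ^ (2 * (l + 1)) = t ^ (2 * (l + 1)) * ‖g w‖ ^ 2 := by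
    intro w hw
    rw [mul_comm 2 (l + 1), pow_mul, ← norm_pow, hGg w hw, norm_mul, norm_pow, hζn, mul_pow,
      ← pow_mul]
  -- The bound on `G ^ (l + 1)` controls `G` only where `‖G‖ ≥ 1`, hence the maximum with 1.
  have hGbdd : ∀ w ∈ Metric.ball (0 : ℂ) 1, ‖G w‖ ≤ max 1 (t ^ (l + 1) * C) := by
    intro w hw
    rcases le_total ‖G w‖ 1 with h | h
    · exact h.trans (le_max_left _ _)
    · refine le_trans ?_ (le_max_right _ _)
      calc ‖G w‖ ≤ ‖G w‖ ^ (l + 1) := le_self_pow₀ h (Nat.succ_ne_zero l)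
        _ = t ^ (l + 1) * ‖g w‖ := by rw [← norm_pow, hGg w hw, norm_mul, norm_pow, hζn]
        _ ≤ t ^ (l + 1) * C := by gcongr; exact hC w hw
  have hGL : MemLp G (2 * (l + 1) : ℕ) area := memLp_of_bounded hGa.continuousOn hGbdd _
  refine ⟨G, ⟨hGa, hGL⟩, ?_, ?_, ?_, ?_⟩
  · rw [norm_eq_one_iff (by omega) hGL, ← htS, hS, ← integral_const_mul]
    exact integral_congr_ae (ae_area_of_forall hGn)
  · have hv' := hv 0 h0
    have hu' := hu₀ 0 trivial
    have e := iteratedDeriv_of_eq_pow_mul (f := G) (m := orderAtOrigin z d)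
      (u := fun w => ζ * (u₀ w * v w)) (by fun_prop)
      (Filter.Eventually.of_forall fun w => by simp only [hG, hprod]; ring)
    have e2 : ζ * (u₀ 0 * v 0) = ((t * ‖c‖ : ℝ) : ℂ) := by
      rw [← hc, hζ, div_mul_cancel₀ _ hc0]
      push_cast
      rfl
    rw [e, e2]
    have hcp : 0 < ‖c‖ := norm_pos_iff.2 hc0
    have : (0 : ℝ) < (orderAtOrigin z d).factorial * (t * ‖c‖) := by positivity
    exact_mod_cast this
  · refine analyticOrderAt_eq_of_eq_prod_mul (K := fun n => (l + 1) * d n) hz hinj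
      (u := fun w => ζ ^ (l + 1) * u w) (fun w hw => analyticAt_const.mul (hu w hw))
      (fun w hw => mul_ne_zero (pow_ne_zero _ hζ0) (hu0 w hw)) fun w hw => ?_
    rw [hGg w hw, hgu w hw]
    ring
  · obtain ⟨c₀, r, hr, h⟩ := (hasCanonicalForm_iff hinj).1 (hform.const_mul hinj (ζ ^ (l + 1)))
    exact (hasCanonicalForm_iff hinj).2 ⟨c₀, r, hr, fun w hw => (hGg w hw).trans (h w hw)⟩

end Bergman

theorem mainTheorem3 (p : ℕ) (hp : Even p) (hp1 : 1 < p)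
    (N : ℕ) (z : Fin N → ℂ) (d : Fin N → ℕ)
    (hz : ∀ n, z n ∈ Metric.ball (0 : ℂ) 1) (hinj : Function.Injective z) (hd : ∀ n, 1 ≤ d n) :
    -- the canonical divisor exists and is unique, as a function in the disc
    (∃ G : ℂ → ℂ, Bergman.IsCanonicalDivisor p z d G ∧
      ∀ H : ℂ → ℂ, Bergman.IsCanonicalDivisor p z d H → Set.EqOn H G (Metric.ball 0 1)) ∧
    -- it is characterized by the norm, the sign, the zeros and the form of `G ^ (p / 2)`
    (∀ G : ℂ → ℂ, Bergman.IsCanonicalDivisor p z d G ↔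
      Bergman.MemSpace p G ∧ Bergman.norm p G = 1 ∧
      0 < iteratedDeriv (Bergman.orderAtOrigin z d) G 0 ∧
      (∀ n, analyticOrderAt (fun w => G w ^ (p / 2)) (z n) = ((p / 2 * d n : ℕ) : ℕ∞)) ∧
      Bergman.HasCanonicalForm (p / 2) z d (fun w => G w ^ (p / 2))) ∧
    -- for sufficiency, it is enough that the zeros have at least the prescribed orders
    (∀ G : ℂ → ℂ, Bergman.MemSpace p G → Bergman.norm p G = 1 →
      0 < iteratedDeriv (Bergman.orderAtOrigin z d) G 0 →
      (∀ n, ((p / 2 * d n : ℕ) : ℕ∞) ≤ analyticOrderAt (fun w => G w ^ (p / 2)) (z n)) →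
      Bergman.HasCanonicalForm (p / 2) z d (fun w => G w ^ (p / 2)) →
      Bergman.IsCanonicalDivisor p z d G) := by
  obtain ⟨l, rfl⟩ : ∃ l, p = 2 * (l + 1) := by
    obtain ⟨k, rfl⟩ := hp
    exact ⟨k - 1, by omega⟩
  rw [Nat.mul_div_cancel_left _ (by norm_num : 0 < 2)]
  have hsuff := fun G hG hG1 hpos hv hform =>
    Bergman.isCanonicalDivisor_of_hasCanonicalForm (l := l) (d := d) (G := G) hz hinj hG hG1 hpos
      hv hform
  obtain ⟨G₀, hG, hG1, hpos, hord, hform⟩ := Bergman.exists_characterized (l := l) (d := d) hz hinj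
  have hcan := hsuff G₀ hG hG1 hpos (fun n => (hord n).ge) hform
  have huniq : ∀ H, Bergman.IsCanonicalDivisor (2 * (l + 1) : ℕ) z d H →
      Set.EqOn H G₀ (Metric.ball 0 1) := fun H hH =>
    Bergman.eqOn_of_isCanonicalDivisor hz hinj hcan (fun n => (hord n).ge) hform hH
  -- Necessity needs no variational argument: by uniqueness a canonical divisor agrees with `G₀` in
  -- the disc, and the zeros and the form depend only on the values there.
  refine ⟨⟨G₀, hcan, huniq⟩, fun G => ⟨fun hGc => ⟨hGc.mem.memSpace, hGc.norm_eq_one, hGc.pos,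
    fun n => ?_, ?_⟩, fun h => hsuff G h.1 h.2.1 h.2.2.1 (fun n => (h.2.2.2.1 n).ge) h.2.2.2.2⟩,
    hsuff⟩
  · rw [← hord n]
    exact analyticOrderAt_congr (Bergman.eventuallyEq_of_eqOn_ball
      (fun w hw => by rw [huniq G hGc hw]) (hz n))
  · obtain ⟨c₀, r, hr, h⟩ := (Bergman.hasCanonicalForm_iff hinj).1 hform
    exact (Bergman.hasCanonicalForm_iff hinj).2 ⟨c₀, r, hr, fun w hw => by
      rw [← h w hw, huniq G hGc hw]⟩
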